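/- Let $n>1$ and let $\mu$ be a positive, locally finite Borel measure on $\mathbb{R}^n$ of the form $$\mu=\sum_{\lambda\in\Lambda}\mu(\lambda)\,\delta_\lambda,\qquad \mu(\lambda)\neq 0\ \ (\lambda\in\Lambda),$$ where $\Lambda\subset\mathbb{R}^n$ is uniformly discrete, that is, $\inf\{|\lambda-\lambda'| : \lambda,\lambda'\in\Lambda,\ \lambda\ne\lambda'\}>0$ (with $\inf\emptyset=+\infty$). Assume that $\mu$ is a temperate distribution and that its Fourier transform $\hat\mu$ in the sense of temperate distributions, $\langle\hat\mu,\varphi\rangle=\langle\mu,\hat\varphi\rangle$ with $\hat\varphi(t)=\int_{\mathbb{R}^n}\varphi(x)e^{-2\pi i\langle t,x\rangle}\,dx$, is a (complex) measure of the form $$\hat\mu=\sum_{s\in S}\hat\mu(s)\,\delta_s,\qquad \hat\mu(s)\neq0\ \ (s\in S),$$ where $S\subset\mathbb{R}^n$ is also uniformly discrete. Then there is a full-rank lattice $L\subset\mathbb{R}^n$ such that $\Lambda$ is contained in a finite union of translates of $L$, and $S$ is contained in a finite union of translates of the dual lattice $L^*=\{y\in\mathbb{R}^n : \langle y,x\rangle\in\mathbb{Z}\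 \text{for all } x\in L\}$. -/

import Mathlib

open MeasureTheory
open scoped SchwartzMap FourierTransform Pointwise

/-- A set `A ⊆ ℝⁿ` is uniformly discrete if the distances between distinct points of `A` are bounded
below by a positive constant. -/
def IsUniformlyDiscrete {n : ℕ} (A : Set (EuclideanSpace ℝ (Fin n))) : Prop :=
  ∃ d : ℝ, 0 < d ∧ A.Pairwise fun x y => d ≤ dist x y

/-- The temperate distribution `T` is the positive measure `μ`: the two agree on all compactly
supported smooth functions (by density, this determines `T`). -/
def IsDistributionOfMeasure {n : ℕ} (T : 𝓢'(EuclideanSpace ℝ (Fin n), ℂ))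
    (μ : Measure (EuclideanSpace ℝ (Fin n))) : Prop :=
  ∀ φ : 𝓢(EuclideanSpace ℝ (Fin n), ℂ), HasCompactSupport (φ : EuclideanSpace ℝ (Fin n) → ℂ) →
    Integrable (φ : EuclideanSpace ℝ (Fin n) → ℂ) μ ∧ T φ = ∫ x, φ x ∂μ

/-- The positive measure `μ` has the form `∑_{x ∈ Λ} μ({x}) δ_x`, where `Λ` is uniformly discrete
and all the masses `μ({x})`, `x ∈ Λ`, are nonzero. -/
structure IsAtomicOn {n : ℕ} (μ : Measure (EuclideanSpace ℝ (Fin n)))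
    (Λ : Set (EuclideanSpace ℝ (Fin n))) : Prop where
  uniformlyDiscrete : IsUniformlyDiscrete Λ
  eq_sum : μ = Measure.sum fun x : Λ => μ {(x : EuclideanSpace ℝ (Fin n))} •
    Measure.dirac (x : EuclideanSpace ℝ (Fin n))
  mass_ne_zero : ∀ x ∈ Λ, μ {x} ≠ 0

/-- The temperate distribution `T` is a complex measure `∑_{s ∈ S} b(s) δ_s`, where `S` is uniformly
discrete and all the masses `b(s)`, `s ∈ S`, are nonzero. The equality is tested on compactly
supported smooth functions, for which the sum has finitely many nonzero terms. -/
structure IsComplexAtomicOn {n : ℕ} (T : 𝓢'(EuclideanSpace ℝ (Fin n), ℂ))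
    (S : Set (EuclideanSpace ℝ (Fin n))) (b : EuclideanSpace ℝ (Fin n) → ℂ) : Prop where
  uniformlyDiscrete : IsUniformlyDiscrete S
  hasSum : ∀ φ : 𝓢(EuclideanSpace ℝ (Fin n), ℂ),
    HasCompactSupport (φ : EuclideanSpace ℝ (Fin n) → ℂ) →
      HasSum (fun s : S => b s * φ s) (T φ)
  mass_ne_zero : ∀ s ∈ S, b s ≠ 0

/-- The dual lattice: all `y` such that `⟨y, x⟩ ∈ ℤ` for every `x ∈ L`. -/
noncomputable def dualLattice {n : ℕ} (L : Submodule ℤ (EuclideanSpace ℝ (Fin n))) :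
    Submodule ℤ (EuclideanSpace ℝ (Fin n)) :=
  LinearMap.BilinForm.dualSubmodule (innerₗ (EuclideanSpace ℝ (Fin n))) L

theorem mem_dualLattice {n : ℕ} {L : Submodule ℤ (EuclideanSpace ℝ (Fin n))}
    {y : EuclideanSpace ℝ (Fin n)} :
    y ∈ dualLattice L ↔ ∀ x ∈ L, ∃ m : ℤ, inner ℝ y x = (m : ℝ) := by
  simp only [dualLattice, LinearMap.BilinForm.mem_dualSubmodule, Submodule.mem_one,
    innerₗ_apply_apply, algebraMap_int_eq, eq_intCast, eq_comm]

/-! Everything is drawn from the Poisson formula `∑ m(x) 𝓕φ(x) = ∑ b(s) φ(s)`. Write `e(t)` for `𝐞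
t`. The masses are bounded: the modulations of one `φ` with `𝓕φ ≥ 0` test every point of Λ against
the same bound.

Relative density (`tsum_correlation_eq`, `exists_relatively_dense`). Let `q = 𝓕φ ≥ 0` with `φ`
supported in a ball whose radius is the separation of S. Then `∑ m(x) q(x - t) e(-⟪s, x⟫) = b(s)
φ(0)` does not involve `t`. As `m` is a pointwise limit of uniformly bounded trigonometric
polynomials with frequencies in S, `∑ m(x) m(x + a) q(x - t)` does not involve `t` either. By
positivity, `Λ ∩ (Λ - a)`, if nonempty, meets every ball of a radius `R` independent of `a`. Hence
`Λ - Λ ⊆ Λ - F` with `F` finite: Λ is a Meyer set. So `Λ - x₀` generates a finitely generated group,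
and each integer coordinate `f j` on it is, up to a bounded error, a linear functional `⟪y j, ·⟫`
(`exists_inner_approx`, by Hyers' theorem).

Rigidity (`eq_zero_of_bounded`). If an integer valued additive `f` is within bounded distance of
`⟪y, ·⟫` on `Λ - x₀` and `‖y‖` is below the separation of S, then `y = 0`. Otherwise no two points
of S differ nearly by `y`, so a local exponential sum over Λ times its shift by `y` vanishes;
rewritten in terms of the bounded error `v = f - ⟪y, ·⟫`, this says `F(τ) F(τ + 1) = 0` for an
entire `F` with `F(0) > 0`.

Lattice (`exists_lattice_cover`). By rigidity the `y j` generate a discrete group, which has full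
rank; its dual lattice `L` accounts for all integer coordinates of Λ except a bounded, hence finite,
part. On finitely many translates of `L`, finitely many characters from any translate of a fixed
finite subset of `L*` combine to 1. Multiplication by a character translates the spectrum, so every
point of S is moved by `L*` into a fixed finite part of S (`exists_spectrum_cover`). -/

section

open scoped ContDiff Topology InnerProductSpace
open Filter

/-! ### Sums of an integrable weight over separated sets. -/

section Decay

variable {E : Type*} [NormedAddCommGroup E] [InnerProductSpace ℝ E]

/-- The weight `(1 + ‖x‖) ^ (-(dim E + 1))`. -/
noncomputable def decay (x : E) : ℝ := ((1 + ‖x‖) ^ (Module.finrank ℝ E + 1))⁻¹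

theorem decay_pos (x : E) : 0 < decay x := by
  unfold decay; positivity

theorem decay_le_of_mem_ball {r : ℝ} {x y : E} (hy : y ∈ Metric.ball x r) :
    decay x ≤ (1 + r) ^ (Module.finrank ℝ E + 1) * decay y := by
  have hr : 0 < r := Metric.pos_of_mem_ball hy
  unfold decay
  rw [← div_eq_mul_inv, ← one_div, div_le_div_iff₀ (by positivity) (by positivity), one_mul,
    ← mul_pow]
  refine pow_le_pow_left₀ (by positivity) ?_ _
  have h1 : ‖y‖ ≤ ‖x‖ + ‖y - x‖ := norm_le_insert' y x
  have h2 : ‖y - x‖ < r := by simpa [dist_eq_norm] using hy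
  nlinarith [norm_nonneg x]

variable [FiniteDimensional ℝ E] [MeasurableSpace E] [BorelSpace E]

theorem integrable_decay : Integrable (decay : E → ℝ) := by
  have h := integrable_one_add_norm (E := E) (μ := volume)
    (r := (Module.finrank ℝ E + 1 : ℕ)) (by push_cast; linarith)
  refine h.congr (Eventually.of_forall fun x => ?_)
  simp only [decay]
  rw [Real.rpow_neg (by positivity), Real.rpow_natCast]

/-- The balls of radius `d / 2` about separated points are disjoint, and on each the weight is
comparable to its value at the centre. Taking `U` to be everything gives a uniform bound; taking `U`
far out gives uniformly small tails. -/
theorem exists_sum_decay_le_integral {d : ℝ} (hd : 0 < d) :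
    ∃ C : ℝ, 0 ≤ C ∧ ∀ (F : Finset E) (t : E) (U : Set E), MeasurableSet U →
      (F : Set E).Pairwise (fun x y => d ≤ dist x y) →
      (∀ x ∈ F, Metric.ball (x - t) (d / 2) ⊆ U) →
      ∑ x ∈ F, decay (x - t) ≤ C * ∫ y in U, decay y := by
  set v : ℝ := volume.real (Metric.ball (0 : E) (d / 2)) with hv
  have hvpos : 0 < v := by
    refine ENNReal.toReal_pos (Metric.measure_ball_pos _ _ (by positivity)).ne' ?_
    exact measure_ball_lt_top.ne
  set K : ℝ := (1 + d / 2) ^ (Module.finrank ℝ E + 1) with hK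
  have hKpos : 0 < K := by positivity
  refine ⟨K / v, by positivity, fun F t U hU hF hsub => ?_⟩
  have hball (x : E) : volume.real (Metric.ball x (d / 2)) = v := by
    rw [hv, Measure.real, Measure.real, Measure.addHaar_ball_center]
  have h1 : ∀ x ∈ F, decay (x - t) ≤ K / v * ∫ y in Metric.ball (x - t) (d / 2), decay y := by
    intro x _
    have : ∫ y in Metric.ball (x - t) (d / 2), decay (x - t) ≤
        ∫ y in Metric.ball (x - t) (d / 2), K * decay y := by
      refine setIntegral_mono_on ?_ (integrable_decay.const_mul K).integrableOn
        measurableSet_ball fun y hy => decay_le_of_mem_ball hy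
      exact integrableOn_const (by exact measure_ball_lt_top.ne)
    rw [setIntegral_const, hball, integral_const_mul, smul_eq_mul] at this
    rw [div_mul_eq_mul_div, le_div_iff₀ hvpos]
    linarith
  have hdisj : (F : Set E).Pairwise
      (Function.onFun Disjoint fun x => Metric.ball (x - t) (d / 2)) := by
    intro x hx y hy hxy
    refine Metric.ball_disjoint_ball ?_
    rw [dist_sub_right]
    linarith [hF hx hy hxy]
  calc ∑ x ∈ F, decay (x - t)
      ≤ ∑ x ∈ F, K / v * ∫ y in Metric.ball (x - t) (d / 2), decay y := Finset.sum_le_sum h1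
    _ = K / v * ∫ y in ⋃ x ∈ F, Metric.ball (x - t) (d / 2), decay y := by
        rw [← Finset.mul_sum, integral_biUnion_finset F (fun x _ => measurableSet_ball) hdisj
          (fun x _ => integrable_decay.integrableOn)]
    _ ≤ K / v * ∫ y in U, decay y := by
        refine mul_le_mul_of_nonneg_left ?_ (by positivity)
        refine setIntegral_mono_set integrable_decay.integrableOn
          (Eventually.of_forall fun y => (decay_pos y).le) (LE.le.eventuallyLE ?_)
        exact Set.iUnion₂_subset hsub

theorem exists_sum_decay_le {d : ℝ} (hd : 0 < d) :
    ∃ K : ℝ, 0 < K ∧ ∀ A : Set E, A.Pairwise (fun x y => d ≤ dist x y) → ∀ t : E,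
      Summable (fun x : A => decay ((x : E) - t)) ∧ ∑' x : A, decay ((x : E) - t) ≤ K := by
  obtain ⟨C, hC, h⟩ := exists_sum_decay_le_integral (E := E) hd
  have hint : 0 ≤ ∫ y : E, decay y := integral_nonneg fun y => (decay_pos y).le
  refine ⟨C * (∫ y : E, decay y) + 1, by positivity, fun A hA t => ?_⟩
  have key (u : Finset A) : ∑ x ∈ u, decay ((x : E) - t) ≤ C * (∫ y : E, decay y) + 1 := by
    have := h (u.map (Function.Embedding.subtype _)) t Set.univ MeasurableSet.univ ?_ (by simp)
    · simp only [Finset.sum_map, Function.Embedding.subtype_apply, Measure.restrict_univ] at this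
      linarith
    · refine hA.mono ?_
      intro x hx
      simp only [Finset.coe_map, Function.Embedding.subtype_apply, Set.mem_image] at hx
      obtain ⟨y, -, rfl⟩ := hx
      exact y.2
  have hs := summable_of_sum_le (fun x : A => (decay_pos ((x : E) - t)).le) key
  exact ⟨hs, hs.tsum_le_of_sum_le key⟩

theorem exists_tail_decay_le {d : ℝ} (hd : 0 < d) {ε : ℝ} (hε : 0 < ε) :
    ∃ R : ℝ, 0 < R ∧ ∀ A : Set E, A.Pairwise (fun x y => d ≤ dist x y) → ∀ t : E,
      (∀ x ∈ A, R ≤ ‖x - t‖) → ∑' x : A, decay ((x : E) - t) ≤ ε := by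
  obtain ⟨C, hC, h⟩ := exists_sum_decay_le_integral (E := E) hd
  have hlim : Tendsto (fun k : ℕ => ∫ y in {y : E | (k : ℝ) ≤ ‖y‖}, decay y) atTop (𝓝 0) := by
    have := tendsto_setIntegral_of_antitone (μ := volume) (f := (decay : E → ℝ))
      (s := fun k : ℕ => {y : E | (k : ℝ) ≤ ‖y‖})
      (fun k => measurableSet_le measurable_const measurable_norm)
      (fun i j hij y (hy : (j : ℝ) ≤ ‖y‖) =>
        show (i : ℝ) ≤ ‖y‖ from le_trans (Nat.cast_le.mpr hij) hy)
      ⟨0, integrable_decay.integrableOn⟩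
    have he : ⋂ k : ℕ, {y : E | (k : ℝ) ≤ ‖y‖} = ∅ := by
      ext y
      simp only [Set.mem_iInter, Set.mem_ofPred_eq, Set.mem_empty_iff_false, iff_false, not_forall,
        not_le]
      exact exists_nat_gt _
    rwa [he, setIntegral_empty] at this
  have hlim2 := (hlim.const_mul C)
  rw [mul_zero] at hlim2
  obtain ⟨k, hk⟩ := (hlim2.eventually (gt_mem_nhds hε)).exists
  -- The margin `d` keeps the balls of radius `d / 2` inside the region `k ≤ ‖y‖`.
  refine ⟨k + d, by positivity, fun A hA t hAt => ?_⟩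
  have key (u : Finset A) : ∑ x ∈ u, decay ((x : E) - t) ≤ ε := by
    have := h (u.map (Function.Embedding.subtype _)) t {y : E | (k : ℝ) ≤ ‖y‖}
      (measurableSet_le measurable_const measurable_norm) ?_ ?_
    · simp only [Finset.sum_map, Function.Embedding.subtype_apply] at this
      linarith
    · refine hA.mono ?_
      intro x hx
      simp only [Finset.coe_map, Function.Embedding.subtype_apply, Set.mem_image] at hx
      obtain ⟨y, -, rfl⟩ := hx
      exact y.2
    · intro x hx y hy
      simp only [Finset.mem_map, Function.Embedding.subtype_apply] at hx
      obtain ⟨z, -, rfl⟩ := hx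
      have h1 := hAt z z.2
      have h2 : ‖y - (z - t)‖ < d / 2 := by simpa [dist_eq_norm] using hy
      have h3 : ‖(z : E) - t‖ ≤ ‖y‖ + ‖y - (z - t)‖ := norm_le_norm_add_norm_sub _ _
      simp only [Set.mem_ofPred_eq]
      linarith
  exact (summable_of_sum_le (fun x : A => (decay_pos ((x : E) - t)).le) key).tsum_le_of_sum_le key

theorem Set.Pairwise.finite_inter_closedBall {d : ℝ} (hd : 0 < d) {A : Set E}
    (hA : A.Pairwise (fun x y => d ≤ dist x y)) (R : ℝ) :
    (A ∩ Metric.closedBall 0 R).Finite := by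
  obtain ⟨K, hK, h⟩ := exists_sum_decay_le (E := E) hd
  have hs := (h A hA 0).1
  have hev := hs.tendsto_cofinite_zero.eventually
    (gt_mem_nhds (show 0 < ((1 + |R|) ^ (Module.finrank ℝ E + 1))⁻¹ by positivity))
  rw [Filter.eventually_cofinite] at hev
  refine (hev.image Subtype.val).subset ?_
  rintro x ⟨hxA, hxR⟩
  refine ⟨⟨x, hxA⟩, ?_, rfl⟩
  simp only [sub_zero, Set.mem_ofPred_eq, not_lt, decay]
  have : ‖x‖ ≤ |R| := (mem_closedBall_zero_iff.mp hxR).trans (le_abs_self R)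
  gcongr

theorem Set.Pairwise.finite_inter_of_isBounded {d : ℝ} (hd : 0 < d) {A B : Set E}
    (hA : A.Pairwise (fun x y => d ≤ dist x y)) (hB : Bornology.IsBounded B) :
    (A ∩ B).Finite := by
  obtain ⟨R, hR⟩ := hB.subset_closedBall 0
  exact (hA.finite_inter_closedBall hd R).subset (Set.inter_subset_inter_right _ hR)

theorem Set.Pairwise.countable_of_le_dist {d : ℝ} (hd : 0 < d) {A : Set E}
    (hA : A.Pairwise (fun x y => d ≤ dist x y)) : A.Countable := by
  have : A = ⋃ k : ℕ, A ∩ Metric.closedBall 0 k := by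
    rw [← Set.inter_iUnion, Metric.iUnion_closedBall_nat, Set.inter_univ]
  rw [this]
  exact Set.countable_iUnion fun k => (hA.finite_inter_closedBall hd k).countable

end Decay

/-! ### Fourier transforms of test functions. -/

section FourierTools

variable {E : Type*} [NormedAddCommGroup E] [InnerProductSpace ℝ E]

theorem exists_norm_le_decay (ψ : 𝓢(E, ℂ)) : ∃ K : ℝ, 0 < K ∧ ∀ x, ‖ψ x‖ ≤ K * decay x := by
  have h := fun x => SchwartzMap.one_add_le_sup_seminorm_apply (𝕜 := ℝ)
    (m := (Module.finrank ℝ E + 1, 0)) le_rfl le_rfl ψ x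
  set C := 2 ^ (Module.finrank ℝ E + 1) *
    (Finset.Iic (Module.finrank ℝ E + 1, 0)).sup (fun m => SchwartzMap.seminorm ℝ m.1 m.2) ψ
  refine ⟨|C| + 1, by positivity, fun x => ?_⟩
  have hx := h x
  simp only [norm_iteratedFDeriv_zero] at hx
  rw [decay, ← div_eq_mul_inv, le_div_iff₀ (by positivity), mul_comm]
  exact hx.trans ((le_abs_self C).trans (by linarith))

variable [FiniteDimensional ℝ E] [MeasurableSpace E] [BorelSpace E]

theorem exists_norm_fourier_le_decay {φ : E → ℂ} (h1 : ContDiff ℝ ∞ φ) (h2 : HasCompactSupport φ) :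
    ∃ K : ℝ, 0 < K ∧ ∀ x, ‖𝓕 φ x‖ ≤ K * decay x := by
  obtain ⟨K, hK, h⟩ := exists_norm_le_decay (𝓕 (h2.toSchwartzMap h1))
  exact ⟨K, hK, h⟩

theorem fourier_modulate (φ : E → ℂ) (t x : E) :
    𝓕 (fun v => 𝐞 ⟪v, t⟫_ℝ • φ v) x = 𝓕 φ (x - t) := by
  simp only [Real.fourier_eq]
  congr 1
  ext v
  rw [smul_smul, ← AddChar.map_add_eq_mul, inner_sub_right]
  ring_nf

theorem fourier_translate (φ : E → ℂ) (s x : E) :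
    𝓕 (fun v => φ (v - s)) x = 𝐞 (-⟪s, x⟫_ℝ) • 𝓕 φ x := by
  simp only [Real.fourier_eq]
  rw [← integral_sub_right_eq_self _ (-s), Circle.smul_def, ← integral_smul]
  congr 1
  ext v
  simp only [sub_neg_eq_add, add_sub_cancel_right]
  rw [inner_add_left, neg_add, AddChar.map_add_eq_mul, mul_comm, mul_smul]
  rfl

theorem fourier_dilate (φ : E → ℂ) {c : ℝ} (hc : 0 < c) (x : E) :
    𝓕 (fun v => ((c ^ Module.finrank ℝ E : ℝ) : ℂ) * φ (c • v)) x = 𝓕 φ (c⁻¹ • x) := by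
  simp only [Real.fourier_eq]
  have h := Measure.integral_comp_smul (volume : Measure E)
    (fun v => 𝐞 (-⟪v, c⁻¹ • x⟫_ℝ) • φ v) c
  have h2 : ∀ v : E, ⟪c • v, c⁻¹ • x⟫_ℝ = ⟪v, x⟫_ℝ := by
    intro v
    rw [inner_smul_left, inner_smul_right]
    simp [hc.ne']
  simp only [h2] at h
  have h3 : ∀ v : E, 𝐞 (-⟪v, x⟫_ℝ) • (((c ^ Module.finrank ℝ E : ℝ) : ℂ) * φ (c • v)) =
      ((c ^ Module.finrank ℝ E : ℝ) : ℂ) * (𝐞 (-⟪v, x⟫_ℝ) • φ (c • v)) := by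
    intro v
    rw [mul_smul_comm]
  simp only [h3]
  rw [integral_const_mul, h, abs_of_pos (by positivity), Complex.real_smul, ← mul_assoc,
    ← Complex.ofReal_mul, mul_inv_cancel₀ (by positivity), Complex.ofReal_one, one_mul]

/-- There are smooth functions supported in arbitrarily small balls with nonnegative Fourier
transform. -/
theorem exists_fourier_nonneg {r : ℝ} (hr : 0 < r) :
    ∃ (φ : E → ℂ) (q : E → ℝ), ContDiff ℝ ∞ φ ∧ HasCompactSupport φ ∧
      (∀ x, φ x ≠ 0 → ‖x‖ < r) ∧ (∀ x, 𝓕 φ x = q x) ∧ (∀ x, 0 ≤ q x) ∧ q 0 = 1 := by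
  let f : ContDiffBump (0 : E) := ⟨r / 4, r / 3, by positivity, by linarith⟩
  let g : E → ℂ := fun x => (f x : ℂ)
  have hg1 : ContDiff ℝ ∞ g := Complex.ofRealCLM.contDiff.comp f.contDiff
  have hg2 : HasCompactSupport g := f.hasCompactSupport.comp_left (g := Complex.ofReal) rfl
  have hgi : Integrable g := hg1.continuous.integrable_of_hasCompactSupport hg2
  have hreal (x : E) : (starRingEnd ℂ) (𝓕 g x) = 𝓕 g x := by
    simp only [Real.fourier_eq]
    rw [← integral_conj, ← integral_neg_eq_self]
    congr 1
    ext v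
    simp only [g, Circle.smul_def, smul_eq_mul, map_mul, Complex.conj_ofReal, f.neg,
      inner_neg_left, neg_neg]
    rw [← Circle.coe_inv_eq_conj, ← AddChar.map_neg_eq_inv]
  have hre (x : E) : 𝓕 g x = ((𝓕 g x).re : ℂ) := (Complex.conj_eq_iff_re.mp (hreal x)).symm
  have h0 : 0 < (𝓕 g 0).re := by
    simp only [Real.fourier_eq, inner_zero_right, neg_zero, AddChar.map_zero_eq_one, one_smul, g]
    rw [integral_complex_ofReal, Complex.ofReal_re]
    exact f.integral_pos
  set c := (𝓕 g 0).re with hc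
  -- The bump `g` is real and even, so `𝓕 g` is real, and convolving `g` with itself squares it. The
  -- support radius at most doubles, from `r / 3` to `2 * r / 3`.
  let φ : E → ℂ := fun x => ((c ^ 2)⁻¹ : ℝ) * (convolution g g (ContinuousLinearMap.mul ℂ ℂ) volume) x
  have hconv : HasCompactSupport (convolution g g (ContinuousLinearMap.mul ℂ ℂ) volume) :=
    hg2.convolution _ hg2
  have hsm : ContDiff ℝ ∞ (convolution g g (ContinuousLinearMap.mul ℝ ℂ) volume) :=
    hg2.contDiff_convolution_left _ hg1 hgi.locallyIntegrable
  refine ⟨φ, fun x => (c ^ 2)⁻¹ * (𝓕 g x).re ^ 2, ?_, ?_, ?_, ?_, ?_, ?_⟩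
  · exact contDiff_const.mul hsm
  · exact hconv.mul_left
  · intro x hx
    have hx' : (convolution g g (ContinuousLinearMap.mul ℂ ℂ) volume) x ≠ 0 :=
      right_ne_zero_of_mul hx
    have := support_convolution_subset (L := ContinuousLinearMap.mul ℂ ℂ) (μ := volume)
      (f := g) (g := g) hx'
    obtain ⟨a, ha, b, hb, rfl⟩ := this
    have hsupp : ∀ a, g a ≠ 0 → ‖a‖ < r / 3 := by
      intro a ha
      have : a ∈ Function.support f := fun h => ha (by simp [g, h])
      rw [f.support_eq] at this
      simpa using this
    have := norm_add_le a b
    have := hsupp a ha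
    have := hsupp b hb
    simp only
    linarith
  · intro x
    have : 𝓕 φ x = ((c ^ 2)⁻¹ : ℝ) * 𝓕 (convolution g g (ContinuousLinearMap.mul ℂ ℂ) volume) x := by
      simp only [Real.fourier_eq, φ]
      rw [← integral_const_mul]
      congr 1
      ext v
      rw [mul_smul_comm]
    rw [this, Real.fourier_mul_convolution_eq hgi hgi, hre x]
    push_cast
    simp [sq]
  · intro x
    positivity
  · simp only [← hc]
    field_simp

end FourierTools

/-! ### Truncation of Schwartz functions. -/

section Cutoff

variable {E : Type*} [NormedAddCommGroup E] [InnerProductSpace ℝ E]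

theorem norm_iteratedFDeriv_comp_smul_le {F : Type*} [NormedAddCommGroup F] [NormedSpace ℝ F]
    {f : E → F} (hf : ContDiff ℝ ∞ f) {c : ℝ} (hc : |c| ≤ 1) (i : ℕ) (x : E) :
    ‖iteratedFDeriv ℝ i (fun y => f (c • y)) x‖ ≤ ‖iteratedFDeriv ℝ i f (c • x)‖ := by
  have h := (c • ContinuousLinearMap.id ℝ E).iteratedFDeriv_comp_right
    (hf.of_le (m := i) (mod_cast le_top)) x le_rfl
  have h2 : f ∘ (c • ContinuousLinearMap.id ℝ E) = fun y => f (c • y) := rfl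
  rw [h2] at h
  rw [h]
  refine (ContinuousMultilinearMap.norm_compContinuousLinearMap_le _ _).trans ?_
  refine mul_le_of_le_one_right (norm_nonneg _) (Finset.prod_le_one (fun _ _ => norm_nonneg _) ?_)
  intro _ _
  rw [norm_smul, Real.norm_eq_abs]
  exact mul_le_one₀ hc (norm_nonneg _) ContinuousLinearMap.norm_id_le

variable [FiniteDimensional ℝ E]

/-- Near the origin `1 - f` vanishes; beyond `rIn` a constant bound is also a linear one. After
dilation by `c k` the factor `‖x‖` becomes `c k * ‖x‖`, which is the rate of convergence of the
truncations. -/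
theorem ContDiffBump.norm_iteratedFDeriv_one_sub_le (f : ContDiffBump (0 : E)) (i : ℕ) :
    ∃ C : ℝ, 0 ≤ C ∧ ∀ x, ‖iteratedFDeriv ℝ i (fun y => 1 - f y) x‖ ≤ C * ‖x‖ := by
  have hf : ContDiff ℝ ∞ f := f.contDiff
  obtain ⟨B, hB⟩ := (f.hasCompactSupport.iteratedFDeriv (𝕜 := ℝ) i).exists_bound_of_continuous
    ((hf.of_le (mod_cast le_top)).continuous_iteratedFDeriv' (m := i))
  have hB0 : 0 ≤ B := (norm_nonneg _).trans (hB 0)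
  refine ⟨(1 + B) / f.rIn, by have := f.rIn_pos; positivity, fun x => ?_⟩
  have hr := f.rIn_pos
  rcases lt_or_ge ‖x‖ f.rIn with hx | hx
  · have : (fun y => 1 - f y) =ᶠ[𝓝 x] fun _ => (0 : ℝ) := by
      filter_upwards [Metric.isOpen_ball.mem_nhds
        (show x ∈ Metric.ball (0 : E) f.rIn by simpa using hx)] with y hy
      rw [f.one_of_mem_closedBall (Metric.ball_subset_closedBall hy), sub_self]
    rw [(this.iteratedFDeriv ℝ i).eq_of_nhds]
    have h0 : iteratedFDeriv ℝ i (fun _ : E => (0 : ℝ)) x = 0 := by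
      simp
    rw [h0, norm_zero]
    positivity
  · have h1 : iteratedFDeriv ℝ i (fun y => 1 - f y) x =
        iteratedFDeriv ℝ i (fun _ => (1 : ℝ)) x - iteratedFDeriv ℝ i f x := by
      exact iteratedFDeriv_sub_apply contDiff_const.contDiffAt
        (hf.of_le (mod_cast le_top)).contDiffAt
    have h2 : ‖iteratedFDeriv ℝ i (fun _ : E => (1 : ℝ)) x‖ ≤ 1 := by
      rcases Nat.eq_zero_or_pos i with rfl | hi
      · simp
      · rw [iteratedFDeriv_const_of_ne hi.ne']
        simp
    rw [h1]
    calc _ ≤ 1 + B := (norm_sub_le _ _).trans (add_le_add h2 (hB x))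
      _ ≤ (1 + B) / f.rIn * ‖x‖ := by
        rw [div_mul_eq_mul_div, le_div_iff₀ hr]
        gcongr

/-- Every Schwartz function is the limit of its truncations. -/
theorem SchwartzMap.exists_tendsto_truncation (ψ : 𝓢(E, ℂ)) :
    ∃ (χ : ℕ → E → ℝ) (Ψ : ℕ → 𝓢(E, ℂ)), (∀ k, HasCompactSupport (Ψ k)) ∧
      (∀ k x, Ψ k x = χ k x * ψ x) ∧ (∀ k x, 0 ≤ χ k x) ∧ (∀ k x, χ k x ≤ 1) ∧
      (∀ (k : ℕ) x, ‖x‖ ≤ k → χ k x = 1) ∧ Tendsto Ψ atTop (𝓝 ψ) := by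
  let f : ContDiffBump (0 : E) := ⟨1, 2, by positivity, by norm_num⟩
  have hf : ContDiff ℝ ∞ f := f.contDiff
  let c : ℕ → ℝ := fun k => ((k : ℝ) + 1)⁻¹
  have hc0 (k : ℕ) : 0 < c k := by positivity
  have hc1 (k : ℕ) : c k ≤ 1 := inv_le_one_of_one_le₀ (by simp)
  let χ : ℕ → E → ℝ := fun k x => f (c k • x)
  have hχs (k) : ContDiff ℝ ∞ (χ k) := hf.comp (contDiff_const_smul (c k))
  have hχc (k) : HasCompactSupport (χ k) := f.hasCompactSupport.comp_smul (hc0 k).ne'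
  have hsm (k) : ContDiff ℝ ∞ (fun x => (χ k x : ℂ) * ψ x) :=
    (Complex.ofRealCLM.contDiff.comp (hχs k)).mul (ψ.smooth ⊤)
  have hcs (k) : HasCompactSupport (fun x => (χ k x : ℂ) * ψ x) :=
    ((hχc k).comp_left (g := Complex.ofReal) rfl).mul_right
  refine ⟨χ, fun k => (hcs k).toSchwartzMap (hsm k), hcs, fun k x => rfl,
    fun k x => f.nonneg, fun k x => f.le_one, ?_, ?_⟩
  · intro k x hx
    refine f.one_of_mem_closedBall ?_
    rw [mem_closedBall_zero_iff, norm_smul, Real.norm_eq_abs, abs_of_pos (hc0 k)]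
    change ((k : ℝ) + 1)⁻¹ * ‖x‖ ≤ 1
    rw [inv_mul_le_one₀ (by positivity)]
    linarith
  · rw [(schwartz_withSeminorms ℝ E ℂ).tendsto_nhds _ ψ]
    rintro ⟨j, l⟩ ε hε
    choose C hC0 hC using f.norm_iteratedFDeriv_one_sub_le
    -- One power more than the seminorm asks for absorbs the factor `‖x‖` lost to the cutoff.
    choose D hD0 hD using fun i => ψ.decay (j + 1) i
    set M := ∑ i ∈ Finset.range (l + 1), (l.choose i : ℝ) * (C i * D (l - i)) with hM
    have hM0 : 0 ≤ M := Finset.sum_nonneg fun i _ => by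
      have := hC0 i; have := (hD0 (l - i)).le; positivity
    have key (k : ℕ) : SchwartzMap.seminorm ℝ j l ((hcs k).toSchwartzMap (hsm k) - ψ) ≤ c k * M := by
      rw [← map_neg_eq_map, neg_sub]
      refine SchwartzMap.seminorm_le_bound ℝ j l _ (by have := (hc0 k).le; positivity) fun x => ?_
      have he : (⇑(ψ - (hcs k).toSchwartzMap (hsm k)) : E → ℂ) =
          fun y => (fun z => (1 - f z)) (c k • y) • ψ y := by
        ext y
        simp only [sub_apply, HasCompactSupport.toSchwartzMap_toFun, χ,
          Complex.real_smul, Complex.ofReal_sub, Complex.ofReal_one]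
        change ψ y - (χ k y : ℂ) * ψ y = _
        ring
      have h1f : ContDiff ℝ ∞ (fun z => 1 - f z) := contDiff_const.sub hf
      rw [he]
      have hle := norm_iteratedFDeriv_smul_le (𝕜 := ℝ) (𝕜' := ℝ) (N := ∞) (n := l)
        (f := fun y => (fun z => (1 - f z)) (c k • y)) (g := ψ)
        (h1f.comp (contDiff_const_smul (c k))) (ψ.smooth ⊤) x (mod_cast le_top)
      refine (mul_le_mul_of_nonneg_left hle (by positivity)).trans ?_
      rw [hM, Finset.mul_sum, Finset.mul_sum]
      refine Finset.sum_le_sum fun i _ => ?_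
      have h3 : ‖iteratedFDeriv ℝ i (fun y => (fun z => (1 - f z)) (c k • y)) x‖ ≤
          C i * (c k * ‖x‖) := by
        refine (norm_iteratedFDeriv_comp_smul_le h1f
          (by rw [abs_of_pos (hc0 k)]; exact hc1 k) i x).trans ?_
        refine (hC i _).trans_eq ?_
        rw [norm_smul, Real.norm_eq_abs, abs_of_pos (hc0 k)]
      have h4 := hD (l - i) x
      calc ‖x‖ ^ j * ((l.choose i : ℝ) *
            ‖iteratedFDeriv ℝ i (fun y => (fun z => (1 - f z)) (c k • y)) x‖ *
            ‖iteratedFDeriv ℝ (l - i) ψ x‖)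
          ≤ ‖x‖ ^ j * ((l.choose i : ℝ) * (C i * (c k * ‖x‖)) *
            ‖iteratedFDeriv ℝ (l - i) ψ x‖) := by gcongr
        _ = c k * ((l.choose i : ℝ) * (C i *
            (‖x‖ ^ (j + 1) * ‖iteratedFDeriv ℝ (l - i) ψ x‖))) := by ring
        _ ≤ c k * ((l.choose i : ℝ) * (C i * D (l - i))) := by
            have := hC0 i; have := (hc0 k).le; gcongr
    have hlim : Tendsto (fun k => c k * M) atTop (𝓝 0) := by
      have := (tendsto_one_div_add_atTop_nhds_zero_nat (𝕜 := ℝ)).mul_const M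
      simpa [c] using this
    filter_upwards [hlim.eventually (gt_mem_nhds hε)] with k hk
    exact (key k).trans_lt hk

end Cutoff

/-! ### The Poisson formula extracted from the distributions. -/

/-- A positive mass distribution `m` on `Λ` and a complex one `b` on `S`, both sets being uniformly
discrete and `m` being bounded, that are related by the Poisson summation formula. -/
structure PoissonPair {E : Type*} [NormedAddCommGroup E] [InnerProductSpace ℝ E]
    [FiniteDimensional ℝ E] [MeasurableSpace E] [BorelSpace E]
    (Λ S : Set E) (m : E → ℝ) (b : E → ℂ) : Prop where
  sep_left : ∃ d : ℝ, 0 < d ∧ Λ.Pairwise fun x y => d ≤ dist x y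
  sep_right : ∃ d : ℝ, 0 < d ∧ S.Pairwise fun x y => d ≤ dist x y
  pos : ∀ x ∈ Λ, 0 < m x
  bdd : ∃ C : ℝ, ∀ x ∈ Λ, m x ≤ C
  poisson : ∀ φ : E → ℂ, ContDiff ℝ ∞ φ → HasCompactSupport φ →
    ∑' x : Λ, (m x : ℂ) * 𝓕 φ x = ∑' s : S, b s * φ s

theorem contDiff_modulate {E : Type*} [NormedAddCommGroup E] [InnerProductSpace ℝ E]
    {φ : E → ℂ} (h : ContDiff ℝ ∞ φ) (t : E) : ContDiff ℝ ∞ fun v => 𝐞 ⟪v, t⟫_ℝ • φ v := by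
  simp only [Circle.smul_def, Real.fourierChar_apply, smul_eq_mul]
  have : ContDiff ℝ ∞ fun v : E => ((2 * Real.pi * ⟪v, t⟫_ℝ : ℝ) : ℂ) :=
    Complex.ofRealCLM.contDiff.comp (contDiff_const.mul (contDiff_id.inner ℝ contDiff_const))
  exact (Complex.contDiff_exp.comp (this.mul contDiff_const)).mul h

theorem hasCompactSupport_modulate {E : Type*} [NormedAddCommGroup E] [InnerProductSpace ℝ E]
    {φ : E → ℂ} (h : HasCompactSupport φ) (t : E) :
    HasCompactSupport fun v => 𝐞 ⟪v, t⟫_ℝ • φ v := by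
  simp only [Circle.smul_def, smul_eq_mul]
  exact h.mul_left

section OfDistribution

variable {n : ℕ} {μ : Measure (EuclideanSpace ℝ (Fin n))}
  {Λ S : Set (EuclideanSpace ℝ (Fin n))} {T : 𝓢'(EuclideanSpace ℝ (Fin n), ℂ)}
  {b : EuclideanSpace ℝ (Fin n) → ℂ}

theorem IsAtomicOn.hasSum_of_hasCompactSupport [IsLocallyFiniteMeasure μ] (hμ : IsAtomicOn μ Λ)
    (hT : IsDistributionOfMeasure T μ) (φ : 𝓢(EuclideanSpace ℝ (Fin n), ℂ))
    (hφ : HasCompactSupport (φ : EuclideanSpace ℝ (Fin n) → ℂ)) :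
    HasSum (fun x : Λ => (μ.real {(x : EuclideanSpace ℝ (Fin n))} : ℂ) * φ x) (T φ) := by
  obtain ⟨hint, hTφ⟩ := hT φ hφ
  have he := hμ.eq_sum
  have h1 := hasSum_integral_measure (μ := fun x : Λ => μ {(x : EuclideanSpace ℝ (Fin n))} •
    Measure.dirac (x : EuclideanSpace ℝ (Fin n))) (f := φ)
    (by have := congrArg (fun ν => Integrable φ ν) he; exact this.mp hint)
  have h2 := congrArg (fun ν => ∫ x, φ x ∂ν) he
  rw [← h2, ← hTφ] at h1
  have h3 (x : Λ) : ∫ y, φ y ∂(μ {(x : EuclideanSpace ℝ (Fin n))} •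
      Measure.dirac (x : EuclideanSpace ℝ (Fin n))) =
      (μ.real {(x : EuclideanSpace ℝ (Fin n))} : ℂ) * φ x := by
    rw [integral_smul_measure, integral_dirac]
    simp [Measure.real]
  simp only [h3] at h1
  exact h1

theorem finite_subtype_ne_zero {E : Type*} [NormedAddCommGroup E] [InnerProductSpace ℝ E]
    [FiniteDimensional ℝ E] [MeasurableSpace E] [BorelSpace E] {S : Set E}
    (hS : ∃ d : ℝ, 0 < d ∧ S.Pairwise fun x y => d ≤ dist x y) {φ : E → ℂ}
    (hφ : HasCompactSupport φ) : {s : S | φ s ≠ 0}.Finite := by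
  obtain ⟨d, hd, hS⟩ := hS
  refine Set.Finite.of_finite_image ?_ Subtype.val_injective.injOn
  refine (hS.finite_inter_of_isBounded hd hφ.isBounded).subset ?_
  rintro _ ⟨s, hs, rfl⟩
  exact ⟨s.2, subset_tsupport _ hs⟩

theorem summable_of_hasCompactSupport {E : Type*} [NormedAddCommGroup E] [InnerProductSpace ℝ E]
    [FiniteDimensional ℝ E] [MeasurableSpace E] [BorelSpace E] {S : Set E}
    (hS : ∃ d : ℝ, 0 < d ∧ S.Pairwise fun x y => d ≤ dist x y) (b : E → ℂ) {φ : E → ℂ}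
    (hφ : HasCompactSupport φ) : Summable fun s : S => b s * φ s := by
  refine summable_of_hasFiniteSupport ((finite_subtype_ne_zero hS hφ).subset fun s hs => ?_)
  exact right_ne_zero_of_mul hs

/-- Modulating `φ` by `t` recentres `q = 𝓕φ` at `t` and leaves every `‖b s * φ s‖` unchanged. As `q
≥ 0` and `q 0 = 1`, the mass at `t` is at most the whole sum. The function `𝓕 Φ` need not be
compactly supported, so it is reached through truncations. -/
theorem IsAtomicOn.exists_mass_le [IsLocallyFiniteMeasure μ] (hμ : IsAtomicOn μ Λ)
    (hT : IsDistributionOfMeasure T μ) (hS : IsComplexAtomicOn (𝓕 T) S b) :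
    ∃ C : ℝ, ∀ x ∈ Λ, μ.real {x} ≤ C := by
  obtain ⟨φ, q, h1, h2, -, hq, hq0, hq1⟩ := exists_fourier_nonneg
    (E := EuclideanSpace ℝ (Fin n)) one_pos
  refine ⟨∑' s : S, ‖b s * φ s‖, fun t ht => ?_⟩
  let Φ := (hasCompactSupport_modulate h2 t).toSchwartzMap (contDiff_modulate h1 t)
  have hb : ‖T (𝓕 Φ)‖ ≤ ∑' s : S, ‖b s * φ s‖ := by
    have hsum := hS.hasSum Φ (hasCompactSupport_modulate h2 t)
    have hT : (𝓕 T) Φ = T (𝓕 Φ) := rfl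
    rw [← hT, ← hsum.tsum_eq]
    have hn (s : S) : ‖b s * Φ s‖ = ‖b s * φ s‖ := by
      have : Φ s = 𝐞 ⟪(s : EuclideanSpace ℝ (Fin n)), t⟫_ℝ • φ s := rfl
      rw [this, norm_mul, norm_mul, Circle.norm_smul]
    have hs : Summable fun s : S => ‖b s * Φ s‖ := by
      simp only [hn]
      exact (summable_of_hasCompactSupport hS.uniformlyDiscrete b h2).norm
    refine (norm_tsum_le_tsum_norm hs).trans_eq ?_
    simp only [hn]
  refine le_trans ?_ hb
  obtain ⟨χ, Ψ, hΨc, hΨ, hχ0, hχ1, hχ, hlim⟩ := (𝓕 Φ).exists_tendsto_truncation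
  have hlim' : Tendsto (fun k => ‖T (Ψ k)‖) atTop (𝓝 ‖T (𝓕 Φ)‖) :=
    ((T.continuous.tendsto _).comp hlim).norm
  refine ge_of_tendsto hlim' ?_
  obtain ⟨k₀, hk₀⟩ := exists_nat_ge ‖t‖
  filter_upwards [eventually_ge_atTop k₀] with k hk
  have hFΦ (x : EuclideanSpace ℝ (Fin n)) : (𝓕 Φ) x = (q (x - t) : ℂ) := (fourier_modulate φ t x).trans (hq _)
  have hsum := hμ.hasSum_of_hasCompactSupport hT (Ψ k) (hΨc k)
  have he (x : Λ) : (μ.real {(x : EuclideanSpace ℝ (Fin n))} : ℂ) * Ψ k x =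
      ((μ.real {(x : EuclideanSpace ℝ (Fin n))} * (χ k x * q (x - t)) : ℝ) : ℂ) := by
    rw [hΨ, hFΦ]; push_cast; ring
  simp only [he] at hsum
  have hsr : Summable fun x : Λ => μ.real {(x : EuclideanSpace ℝ (Fin n))} *
      (χ k x * q (x - t)) := Complex.summable_ofReal.mp hsum.summable
  rw [← hsum.tsum_eq, ← Complex.ofReal_tsum, Complex.norm_real]
  refine le_trans ?_ (le_abs_self _)
  have := hsr.le_tsum ⟨t, ht⟩ fun x _ => mul_nonneg measureReal_nonneg
    (mul_nonneg (hχ0 _ _) (hq0 _))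
  rwa [hχ k t (hk₀.trans (Nat.cast_le.mpr hk)), sub_self, hq1, mul_one, mul_one] at this

theorem IsAtomicOn.poissonPair [IsLocallyFiniteMeasure μ] (hμ : IsAtomicOn μ Λ)
    (hT : IsDistributionOfMeasure T μ) (hS : IsComplexAtomicOn (𝓕 T) S b) :
    PoissonPair Λ S (fun x => μ.real {x}) b where
  sep_left := hμ.uniformlyDiscrete
  sep_right := hS.uniformlyDiscrete
  pos x hx := ENNReal.toReal_pos (hμ.mass_ne_zero x hx) (measure_singleton_lt_top).ne
  bdd := hμ.exists_mass_le hT hS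
  poisson φ h1 h2 := by
    obtain ⟨C, hC⟩ := hμ.exists_mass_le hT hS
    obtain ⟨d, hd, hΛ⟩ := hμ.uniformlyDiscrete
    let Φ := h2.toSchwartzMap h1
    obtain ⟨K, hK, hKΦ⟩ := exists_norm_le_decay (𝓕 Φ)
    obtain ⟨χ, Ψ, hΨc, hΨ, hχ0, hχ1, hχ, hlim⟩ := (𝓕 Φ).exists_tendsto_truncation
    have hlim1 : Tendsto (fun k => T (Ψ k)) atTop (𝓝 (T (𝓕 Φ))) :=
      (T.continuous.tendsto _).comp hlim
    -- The mass bound makes `C * K * decay` a summable majorant for all truncations.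
    have hlim2 : Tendsto (fun k => T (Ψ k)) atTop
        (𝓝 (∑' x : Λ, (μ.real {(x : EuclideanSpace ℝ (Fin n))} : ℂ) * 𝓕 Φ x)) := by
      simp only [fun k => ((hμ.hasSum_of_hasCompactSupport hT (Ψ k) (hΨc k)).tsum_eq).symm]
      obtain ⟨_, _, hdec⟩ := exists_sum_decay_le (E := EuclideanSpace ℝ (Fin n)) hd
      have hdec := (hdec Λ hΛ 0).1
      simp only [sub_zero] at hdec
      refine tendsto_tsum_of_dominated_convergence (hdec.mul_left (C * K)) ?_ ?_
      · intro x
        refine tendsto_const_nhds.congr' ?_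
        obtain ⟨k₀, hk₀⟩ := exists_nat_ge ‖(x : EuclideanSpace ℝ (Fin n))‖
        filter_upwards [eventually_ge_atTop k₀] with k hk
        rw [hΨ, hχ k x (hk₀.trans (Nat.cast_le.mpr hk)), Complex.ofReal_one, one_mul]
      · refine Eventually.of_forall fun k x => ?_
        rw [hΨ, norm_mul, norm_mul, Complex.norm_real, Complex.norm_real, Real.norm_eq_abs,
          Real.norm_eq_abs, abs_of_nonneg measureReal_nonneg, abs_of_nonneg (hχ0 _ _), mul_assoc]
        have hC0 : 0 ≤ C := measureReal_nonneg.trans (hC x x.2)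
        refine mul_le_mul (hC x x.2) ?_ (by have := hχ0 k x; positivity) hC0
        exact (mul_le_of_le_one_left (norm_nonneg _) (hχ1 k x)).trans (hKΦ x)
    have huniq := tendsto_nhds_unique hlim2 hlim1
    exact huniq.trans (hS.hasSum Φ h2).tsum_eq.symm

end OfDistribution

/-! ### Correlations and uniform relative density. -/

section Correlation

variable {E : Type*} [NormedAddCommGroup E] [InnerProductSpace ℝ E]

theorem decay_smul_le {a : ℝ} (ha : 1 ≤ a) (x : E) : decay (a • x) ≤ decay x := by
  unfold decay
  rw [norm_smul, Real.norm_eq_abs, abs_of_pos (by linarith)]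
  gcongr
  nlinarith [norm_nonneg x]

theorem tendsto_decay_smul {x : E} (hx : x ≠ 0) :
    Tendsto (fun k : ℕ => decay (((k : ℝ) + 1) • x)) atTop (𝓝 0) := by
  unfold decay
  refine Tendsto.inv_tendsto_atTop ?_
  refine (tendsto_pow_atTop (Nat.succ_ne_zero _)).comp ?_
  refine tendsto_atTop_add_const_left _ _ ?_
  have : Tendsto (fun k : ℕ => ((k : ℝ) + 1) * ‖x‖) atTop atTop :=
    (tendsto_atTop_add_const_right _ _ tendsto_natCast_atTop_atTop).atTop_mul_const
      (norm_pos_iff.mpr hx)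
  refine this.congr fun k => ?_
  rw [norm_smul, Real.norm_eq_abs, abs_of_pos (by positivity)]

variable [FiniteDimensional ℝ E] [MeasurableSpace E] [BorelSpace E] {Λ S : Set E} {m : E → ℝ} {b : E → ℂ}

namespace PoissonPair

theorem summable_of_le_decay (h : PoissonPair Λ S m b) {g : E → ℝ} {K : ℝ} (t : E)
    (hg : ∀ x, |g x| ≤ K * decay (x - t)) : Summable fun x : Λ => m x * g x := by
  obtain ⟨d, hd, hΛ⟩ := h.sep_left
  obtain ⟨C, hC⟩ := h.bdd
  obtain ⟨_, -, hdec⟩ := exists_sum_decay_le (E := E) hd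
  refine ((hdec Λ hΛ t).1.mul_left (C * K)).of_norm_bounded fun x => ?_
  rw [Real.norm_eq_abs, abs_mul, abs_of_pos (h.pos x x.2), mul_assoc]
  exact mul_le_mul (hC x x.2) (hg x) (abs_nonneg _) ((h.pos x x.2).le.trans (hC x x.2))

/-- The weight of a point of `S` is recovered from test functions supported near the origin. -/
theorem tsum_mul_fourierChar (h : PoissonPair Λ S m b) {d : ℝ}
    (hS : S.Pairwise fun x y => d ≤ dist x y) {φ : E → ℂ} (h1 : ContDiff ℝ ∞ φ)
    (h2 : HasCompactSupport φ) (hφ : ∀ x, φ x ≠ 0 → ‖x‖ < d) {q : E → ℝ}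
    (hq : ∀ x, 𝓕 φ x = q x) (t : E) (s : S) :
    ∑' x : Λ, ((m x * q (x - t) : ℝ) : ℂ) * 𝐞 (-⟪(s : E), x⟫_ℝ) = b s * φ 0 := by
  -- Only `s` itself survives on the spectral side, where the modulation factor is 1; this removes
  -- `t`.
  have h3 := h.poisson (fun v => (fun w => 𝐞 ⟪w, t⟫_ℝ • φ w) (v - s))
    ((contDiff_modulate h1 t).comp (contDiff_id.sub contDiff_const))
    ((hasCompactSupport_modulate h2 t).comp_homeomorph (Homeomorph.subRight (s : E)))
  rw [tsum_eq_single s] at h3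
  · simp only [sub_self, inner_zero_left, AddChar.map_zero_eq_one, one_smul] at h3
    rw [← h3]
    refine tsum_congr fun x => ?_
    have hf := fourier_translate (fun w => 𝐞 ⟪w, t⟫_ℝ • φ w) s x
    rw [fourier_modulate, hq, Circle.smul_def, smul_eq_mul] at hf
    rw [hf]
    push_cast
    ring
  · intro s' hs'
    have hne : (s' : E) ≠ s := fun he => hs' (Subtype.ext he)
    have hd : d ≤ dist (s' : E) s := hS s'.2 s.2 hne
    have : φ (s' - s) = 0 := by
      by_contra hc
      have := hφ _ hc
      rw [dist_eq_norm] at hd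
      linarith
    simp [this]

/-- The smoothed mass at `z`. -/
theorem tsum_smoothing (h : PoissonPair Λ S m b) {κ : E → ℂ} (h1 : ContDiff ℝ ∞ κ)
    (h2 : HasCompactSupport κ) {η : E → ℝ} (hη : ∀ x, 𝓕 κ x = η x) (k : ℕ) :
    ∃ (F : Finset S) (w : S → ℂ), ∀ z : E,
      ((∑' x : Λ, m x * η (((k : ℝ) + 1) • ((x : E) - z)) : ℝ) : ℂ) =
        ∑ s ∈ F, w s * 𝐞 ⟪(s : E), z⟫_ℝ := by
  set c : ℝ := ((k : ℝ) + 1)⁻¹ with hc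
  have hc0 : 0 < c := by positivity
  set κ' : E → ℂ := fun v => ((c ^ Module.finrank ℝ E : ℝ) : ℂ) * κ (c • v) with hκ'
  have h1' : ContDiff ℝ ∞ κ' := contDiff_const.mul (h1.comp (contDiff_const_smul c))
  have h2' : HasCompactSupport κ' := (h2.comp_smul hc0.ne').mul_left
  -- Compact support of `κ'` is what makes the smoothed mass a trigonometric polynomial in `z`.
  have hfin := finite_subtype_ne_zero h.sep_right h2'
  refine ⟨hfin.toFinset, fun s => b s * κ' s, fun z => ?_⟩
  have h3 := h.poisson _ (contDiff_modulate h1' z) (hasCompactSupport_modulate h2' z)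
  rw [tsum_eq_sum (s := hfin.toFinset)] at h3
  · rw [Complex.ofReal_tsum]
    refine Eq.trans (tsum_congr fun x => ?_) (h3.trans (Finset.sum_congr rfl fun s _ => ?_))
    · rw [fourier_modulate, hκ', fourier_dilate κ hc0, hη, hc, inv_inv]
      push_cast
      ring
    · rw [Circle.smul_def, smul_eq_mul]
      ring
  · intro s hs
    have : κ' s = 0 := by simpa using hs
    simp [this]

/-- The dilated kernel stays 1 at `x = z` and tends to 0 at every other point of Λ; the decay of `η`
dominates. -/
theorem tendsto_smoothing (h : PoissonPair Λ S m b) {η : E → ℝ} {K : ℝ}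
    (hK : ∀ x, |η x| ≤ K * decay x) (h0 : η 0 = 1) (z : E) :
    Tendsto (fun k : ℕ => ∑' x : Λ, m x * η (((k : ℝ) + 1) • ((x : E) - z))) atTop
      (𝓝 (Λ.indicator m z)) := by
  classical
  obtain ⟨d, hd, hΛ⟩ := h.sep_left
  obtain ⟨C, hC⟩ := h.bdd
  obtain ⟨_, -, hdec⟩ := exists_sum_decay_le (E := E) hd
  have hK0 : 0 ≤ K := by
    have := hK 0
    exact nonneg_of_mul_nonneg_left ((abs_nonneg _).trans this) (decay_pos _)
  have hlim : Λ.indicator m z = ∑' x : Λ, if (x : E) = z then m x else 0 := by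
    by_cases hz : z ∈ Λ
    · rw [Set.indicator_of_mem hz, tsum_eq_single ⟨z, hz⟩]
      · simp
      · intro x hx
        rw [if_neg fun he => hx (Subtype.ext he)]
    · rw [Set.indicator_of_notMem hz]
      have : ∀ x : Λ, (if (x : E) = z then m x else 0) = 0 := fun x =>
        if_neg fun he : (x : E) = z => hz (he ▸ x.2)
      simp [this]
  rw [hlim]
  refine tendsto_tsum_of_dominated_convergence ((hdec Λ hΛ z).1.mul_left (C * K)) ?_ ?_
  · intro x
    by_cases hx : (x : E) = z
    · simp [hx, h0]
    · rw [if_neg hx]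
      have h1 : Tendsto (fun k : ℕ => K * decay (((k : ℝ) + 1) • ((x : E) - z))) atTop (𝓝 0) := by
        simpa using (tendsto_decay_smul (sub_ne_zero.mpr hx)).const_mul K
      have h2 := squeeze_zero_norm (f := fun k : ℕ => η (((k : ℝ) + 1) • ((x : E) - z)))
        (fun k => hK _) h1
      simpa using h2.const_mul (m x)
  · refine Eventually.of_forall fun k x => ?_
    rw [Real.norm_eq_abs, abs_mul, abs_of_pos (h.pos x x.2), mul_assoc]
    refine mul_le_mul (hC x x.2) ((hK _).trans ?_) (abs_nonneg _)
      ((h.pos x x.2).le.trans (hC x x.2))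
    exact mul_le_mul_of_nonneg_left (decay_smul_le (by simp) _) hK0

theorem abs_smoothing_le (h : PoissonPair Λ S m b) {η : E → ℝ} {K : ℝ}
    (hK : ∀ x, |η x| ≤ K * decay x) :
    ∃ B, ∀ (k : ℕ) (z : E), |∑' x : Λ, m x * η (((k : ℝ) + 1) • ((x : E) - z))| ≤ B := by
  obtain ⟨d, hd, hΛ⟩ := h.sep_left
  obtain ⟨C, hC⟩ := h.bdd
  obtain ⟨D, -, hdec⟩ := exists_sum_decay_le (E := E) hd
  have hK0 : 0 ≤ K := by
    have := hK 0
    exact nonneg_of_mul_nonneg_left ((abs_nonneg _).trans this) (decay_pos _)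
  rcases Λ.eq_empty_or_nonempty with rfl | ⟨x₀, hx₀⟩
  · exact ⟨0, fun k z => by simp⟩
  have hC0 : 0 ≤ C := (h.pos x₀ hx₀).le.trans (hC x₀ hx₀)
  refine ⟨C * K * D, fun k z => ?_⟩
  refine (tsum_of_norm_bounded (f := fun x : Λ => m x * η (((k : ℝ) + 1) • ((x : E) - z)))
    ((hdec Λ hΛ z).1.mul_left (C * K)).hasSum fun x => ?_).trans ?_
  · rw [Real.norm_eq_abs, abs_mul, abs_of_pos (h.pos x x.2), mul_assoc]
    refine mul_le_mul (hC x x.2) ((hK _).trans ?_) (abs_nonneg _) hC0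
    exact mul_le_mul_of_nonneg_left (decay_smul_le (by simp) _) hK0
  · rw [tsum_mul_left]
    exact mul_le_mul_of_nonneg_left (hdec Λ hΛ z).2 (by positivity)

/-- The smoothed averages of the correlation measure
`∑ m(λ) m(λ + a) δ_λ` do not depend on the centre. -/
theorem tsum_correlation_eq (h : PoissonPair Λ S m b) {d : ℝ}
    (hS : S.Pairwise fun x y => d ≤ dist x y) {φ : E → ℂ} (h1 : ContDiff ℝ ∞ φ)
    (h2 : HasCompactSupport φ) (hφ : ∀ x, φ x ≠ 0 → ‖x‖ < d) {q : E → ℝ}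
    (hq : ∀ x, 𝓕 φ x = q x) (a t : E) :
    ∑' x : Λ, m x * q (x - t) * Λ.indicator m (x + a) =
      ∑' x : Λ, m x * q x * Λ.indicator m (x + a) := by
  obtain ⟨κ, η, k1, k2, -, hη, hη0, hη1⟩ := exists_fourier_nonneg (E := E) one_pos
  obtain ⟨K, hK, hKφ⟩ := exists_norm_fourier_le_decay h1 h2
  obtain ⟨K', hK', hKκ⟩ := exists_norm_fourier_le_decay k1 k2
  have hqd (x : E) : |q x| ≤ K * decay x := by
    have := hKφ x
    rwa [hq, Complex.norm_real] at this
  have hηd (x : E) : |η x| ≤ K' * decay x := by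
    have := hKκ x
    rwa [hη, Complex.norm_real] at this
  set N : ℕ → E → ℝ := fun k z => ∑' x : Λ, m x * η (((k : ℝ) + 1) • ((x : E) - z)) with hN
  obtain ⟨B, hB⟩ := h.abs_smoothing_le hηd
  have hsq (t : E) : Summable fun x : Λ => m x * q (x - t) :=
    h.summable_of_le_decay t fun x => hqd _
  have hlim (t : E) : Tendsto (fun k => ∑' x : Λ, m x * q (x - t) * N k (x + a)) atTop
      (𝓝 (∑' x : Λ, m x * q (x - t) * Λ.indicator m (x + a))) := by
    refine tendsto_tsum_of_dominated_convergence ((hsq t).norm.mul_right B) ?_ ?_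
    · exact fun x => (h.tendsto_smoothing hηd hη1 _).const_mul _
    · refine Eventually.of_forall fun k x => ?_
      rw [norm_mul]
      exact mul_le_mul_of_nonneg_left (hB k _) (norm_nonneg _)
  have hconst (k : ℕ) : ∃ c : ℂ, ∀ t : E,
      ((∑' x : Λ, m x * q (x - t) * N k (x + a) : ℝ) : ℂ) = c := by
    obtain ⟨F, w, hF⟩ := h.tsum_smoothing k1 k2 hη k
    refine ⟨∑ s ∈ F, (starRingEnd ℂ) (w s * 𝐞 ⟪(s : E), a⟫_ℝ) * (b s * φ 0), fun t => ?_⟩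
    -- `N k z` is real, so conjugating is free and turns its characters into the `e(-⟪s, x⟫)` of
    -- `tsum_mul_fourierChar`.
    have hconj (z : E) : (N k z : ℂ) = ∑ s ∈ F, (starRingEnd ℂ) (w s * 𝐞 ⟪(s : E), z⟫_ℝ) := by
      rw [← map_sum, ← hF z, Complex.conj_ofReal]
    have hterm (x : Λ) : ((m x * q (x - t) * N k (x + a) : ℝ) : ℂ) =
        ∑ s ∈ F, (starRingEnd ℂ) (w s * 𝐞 ⟪(s : E), a⟫_ℝ) *
          (((m x * q (x - t) : ℝ) : ℂ) * 𝐞 (-⟪(s : E), x⟫_ℝ)) := by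
      rw [Complex.ofReal_mul, hconj, Finset.mul_sum]
      refine Finset.sum_congr rfl fun s _ => ?_
      rw [inner_add_right, AddChar.map_add_eq_mul, AddChar.map_neg_eq_inv, Circle.coe_mul,
        Circle.coe_inv_eq_conj, map_mul, map_mul, map_mul]
      ring
    have hsum (s : S) : Summable fun x : Λ =>
        ((m x * q (x - t) : ℝ) : ℂ) * 𝐞 (-⟪(s : E), x⟫_ℝ) := by
      refine (hsq t).norm.of_norm_bounded fun x => ?_
      rw [norm_mul, Circle.norm_coe, mul_one, Complex.norm_real]
    rw [Complex.ofReal_tsum]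
    simp only [hterm]
    rw [Summable.tsum_finsetSum fun s _ => (hsum s).mul_left _]
    refine Finset.sum_congr rfl fun s _ => ?_
    rw [tsum_mul_left, h.tsum_mul_fourierChar hS h1 h2 hφ hq]
  have heq : (fun k => ∑' x : Λ, m x * q (x - t) * N k (x + a)) =
      fun k => ∑' x : Λ, m x * q (x - 0) * N k (x + a) := by
    ext k
    obtain ⟨c, hc⟩ := hconst k
    exact_mod_cast (hc t).trans (hc 0).symm
  have := tendsto_nhds_unique (hlim t) (heq ▸ hlim 0)
  simpa using this

/-- All the sets `{x ∈ Λ | x + a ∈ Λ}` with `a ∈ Λ - Λ` are relatively dense with the same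
constant. -/
theorem exists_relatively_dense (h : PoissonPair Λ S m b) :
    ∃ R : ℝ, 0 < R ∧ ∀ a t : E, (∃ x ∈ Λ, x + a ∈ Λ) → ∃ x ∈ Λ, ‖x - t‖ ≤ R ∧ x + a ∈ Λ := by
  obtain ⟨dS, hdS, hS⟩ := h.sep_right
  obtain ⟨d, hd, hΛ⟩ := h.sep_left
  obtain ⟨φ, q, h1, h2, hφ, hq, hq0, hq1⟩ := exists_fourier_nonneg (E := E) hdS
  obtain ⟨K, hK, hKφ⟩ := exists_norm_fourier_le_decay h1 h2
  have hqd (x : E) : |q x| ≤ K * decay x := by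
    have := hKφ x
    rwa [hq, Complex.norm_real] at this
  -- With this tail, an empty ball of radius `R` would give `I ≤ I * K * (2 * K)⁻¹ = I / 2`. The
  -- estimate is homogeneous in `I`, hence `R` does not depend on `a`.
  obtain ⟨R, hR, htail⟩ := exists_tail_decay_le (E := E) hd (ε := (2 * K)⁻¹) (by positivity)
  refine ⟨R, hR, fun a t ⟨x₀, hx₀, hx₀a⟩ => ?_⟩
  by_contra hcon
  push Not at hcon
  set w : E → ℝ := fun x => m x * Λ.indicator m (x + a) with hw
  have hw0 (x : Λ) : 0 ≤ w x :=
    mul_nonneg (h.pos x x.2).le (Set.indicator_nonneg (fun y hy => (h.pos y hy).le) _)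
  set I : ℝ := ∑' x : Λ, w x * q x with hI
  have hIt (t : E) : ∑' x : Λ, w x * q (x - t) = I := by
    have := h.tsum_correlation_eq hS h1 h2 hφ hq a t
    simpa only [hw, hI, mul_right_comm] using this
  obtain ⟨C, hC⟩ := h.bdd
  have hsum (t : E) : Summable fun x : Λ => w x * q (x - t) := by
    have := (h.summable_of_le_decay t fun x => hqd (x - t)).norm.mul_right C
    refine this.of_norm_bounded fun x => ?_
    rw [hw, mul_right_comm, norm_mul]
    refine mul_le_mul_of_nonneg_left ?_ (norm_nonneg _)
    have hC0 : 0 ≤ C := (h.pos x x.2).le.trans (hC x x.2)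
    by_cases hxa : (x : E) + a ∈ Λ
    · rw [Set.indicator_of_mem hxa, Real.norm_eq_abs, abs_of_pos (h.pos _ hxa)]
      exact hC _ hxa
    · rw [Set.indicator_of_notMem hxa, norm_zero]
      exact hC0
  -- Centring the sum at `x` itself, as its value does not depend on the centre.
  have hwI (x : Λ) : w x ≤ I := by
    have := (hsum x).le_tsum x fun y _ => mul_nonneg (hw0 y) (hq0 _)
    rwa [hIt, sub_self, hq1, mul_one] at this
  have hIpos : 0 < I := by
    refine lt_of_lt_of_le ?_ (hwI ⟨x₀, hx₀⟩)
    simp only [hw, Set.indicator_of_mem hx₀a]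
    exact mul_pos (h.pos _ hx₀) (h.pos _ hx₀a)
  set A : Set E := {x ∈ Λ | R ≤ ‖x - t‖} with hA
  have hAΛ : A ⊆ Λ := fun x hx => hx.1
  obtain ⟨_, -, hdec⟩ := exists_sum_decay_le (E := E) hd
  have hAs := (hdec A (hΛ.mono hAΛ) t).1
  have hAt := htail A (hΛ.mono hAΛ) t fun x hx => hx.2
  have hsupp : ∀ x : E, Λ.indicator (fun x => w x * q (x - t)) x =
      A.indicator (fun x => w x * q (x - t)) x := by
    intro x
    by_cases hx : x ∈ Λ
    · by_cases hxR : R ≤ ‖x - t‖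
      · rw [Set.indicator_of_mem hx, Set.indicator_of_mem (show x ∈ A from ⟨hx, hxR⟩)]
      · rw [Set.indicator_of_mem hx, Set.indicator_of_notMem (show x ∉ A from fun hxA => hxR hxA.2)]
        simp only [hw]
        rw [Set.indicator_of_notMem (hcon x hx (not_le.mp hxR).le), mul_zero, zero_mul]
    · rw [Set.indicator_of_notMem hx, Set.indicator_of_notMem fun hxA => hx hxA.1]
  have h3 : I = ∑' x : A, w x * q (x - t) := by
    rw [← hIt t, tsum_subtype Λ (fun x => w x * q (x - t)),
      tsum_subtype A (fun x => w x * q (x - t))]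
    exact tsum_congr hsupp
  have h4 : ∑' x : A, w x * q (x - t) ≤ ∑' x : A, I * K * decay ((x : E) - t) := by
    have hle (x : A) : w x * q (x - t) ≤ I * K * decay ((x : E) - t) := by
      exact (mul_le_mul (hwI ⟨x, hAΛ x.2⟩) ((le_abs_self _).trans (hqd _)) (hq0 _)
        hIpos.le).trans_eq (mul_assoc _ _ _).symm
    refine Summable.tsum_le_tsum hle ?_ (hAs.mul_left _)
    exact Summable.of_nonneg_of_le
      (fun x => mul_nonneg (hw0 ⟨x, hAΛ x.2⟩) (hq0 _)) hle (hAs.mul_left _)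
  rw [tsum_mul_left] at h4
  have h5 : I * K * ∑' x : A, decay ((x : E) - t) ≤ I * K * (2 * K)⁻¹ :=
    mul_le_mul_of_nonneg_left hAt (by positivity)
  have h6 : I * K * (2 * K)⁻¹ = I / 2 := by field_simp
  linarith

end PoissonPair

end Correlation

/-! ### Uniqueness of coefficients of exponential sums. -/

section Uniqueness

variable {E : Type*} [NormedAddCommGroup E] [InnerProductSpace ℝ E] [FiniteDimensional ℝ E]
  [MeasurableSpace E] [BorelSpace E]

/-- Integrating the vanishing sum, at `-v`, against the inverse transform of `θ` and exchanging sum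
and integral. -/
theorem tsum_mul_schwartz_eq_zero {ι : Type*} [Countable ι] {A : ι → ℂ} {g : ι → E}
    (hA : Summable fun i => ‖A i‖) (h0 : ∀ u, ∑' i, A i * 𝐞 ⟪g i, u⟫_ℝ = 0) (θ : 𝓢(E, ℂ)) :
    ∑' i, A i * θ (g i) = 0 := by
  set φ : 𝓢(E, ℂ) := 𝓕⁻ θ with hφ
  have hθ (x : E) : θ x = 𝓕 (φ : E → ℂ) x := by
    have : 𝓕 φ = θ := FourierTransform.fourier_fourierInv_eq θ
    rw [← this]
    rfl
  have hint (i : ι) : Integrable fun v => A i * (𝐞 (-⟪v, g i⟫_ℝ) • φ v) :=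
    ((Real.fourierIntegral_convergent_iff (g i)).2 φ.integrable).const_mul _
  have hnorm (i : ι) : ∫ v, ‖A i * (𝐞 (-⟪v, g i⟫_ℝ) • φ v)‖ = ‖A i‖ * ∫ v, ‖φ v‖ := by
    simp only [norm_mul, Circle.norm_smul]
    rw [integral_const_mul]
  have h1 := integral_tsum_of_summable_integral_norm hint
    (by simp only [hnorm]; exact hA.mul_right _)
  have h2 (v : E) : ∑' i, A i * (𝐞 (-⟪v, g i⟫_ℝ) • φ v) = 0 := by
    have := congrArg (· * φ v) (h0 (-v))
    simp only [zero_mul] at this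
    rw [← tsum_mul_right] at this
    rw [← this]
    refine tsum_congr fun i => ?_
    rw [Circle.smul_def, smul_eq_mul, inner_neg_right, real_inner_comm]
    ring
  simp only [h2, integral_zero] at h1
  rw [← h1]
  refine tsum_congr fun i => ?_
  rw [hθ, Real.fourier_eq, integral_const_mul]

/-- Bumps shrinking to `y` isolate the indices of frequency `y`. Distinct indices may share a
frequency, so only fibre sums vanish. -/
theorem tsum_fiber_eq_zero {ι : Type*} [Countable ι] {A : ι → ℂ} {g : ι → E}
    (hA : Summable fun i => ‖A i‖) (h0 : ∀ u, ∑' i, A i * 𝐞 ⟪g i, u⟫_ℝ = 0) (y : E) :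
    ∑' i : g ⁻¹' {y}, A i = 0 := by
  classical
  let f : ℕ → ContDiffBump y := fun k =>
    ⟨((k : ℝ) + 1)⁻¹ / 2, ((k : ℝ) + 1)⁻¹, by positivity, half_lt_self (by positivity)⟩
  let θ : ℕ → 𝓢(E, ℂ) := fun k =>
    ((f k).hasCompactSupport.comp_left (g := Complex.ofReal) rfl).toSchwartzMap
      (Complex.ofRealCLM.contDiff.comp (f k).contDiff)
  have hθ (k : ℕ) (x : E) : θ k x = (f k x : ℂ) := rfl
  have hlim : Tendsto (fun k => ∑' i, A i * θ k (g i)) atTop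
      (𝓝 (∑' i, (g ⁻¹' {y}).indicator A i)) := by
    refine tendsto_tsum_of_dominated_convergence hA ?_ ?_
    · intro i
      refine tendsto_const_nhds.congr' ?_
      by_cases hi : g i = y
      · refine Eventually.of_forall fun k => ?_
        beta_reduce
        rw [Set.indicator_of_mem (by exact hi), hθ, hi, (f k).one_of_mem_closedBall
          (Metric.mem_closedBall_self (f k).rIn_pos.le), Complex.ofReal_one, mul_one]
      · have hpos : 0 < dist (g i) y := dist_pos.mpr hi
        filter_upwards [tendsto_one_div_add_atTop_nhds_zero_nat.eventually (gt_mem_nhds hpos)]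
          with k hk
        rw [Set.indicator_of_notMem (by exact hi), hθ, (f k).zero_of_le_dist, Complex.ofReal_zero,
          mul_zero]
        rw [one_div] at hk
        exact hk.le
    · refine Eventually.of_forall fun k i => ?_
      rw [norm_mul, hθ, Complex.norm_real, Real.norm_eq_abs, abs_of_nonneg (f k).nonneg]
      exact mul_le_of_le_one_right (norm_nonneg _) (f k).le_one
  simp only [tsum_mul_schwartz_eq_zero hA h0] at hlim
  rw [tsum_subtype]
  exact tendsto_nhds_unique hlim tendsto_const_nhds

/-- An absolutely convergent exponential sum that vanishes identically has vanishing coefficients,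
so that its exponentials may be replaced by any bounded function of the frequency. -/
theorem tsum_mul_eq_zero_of_forall_fourierChar {ι : Type*} [Countable ι] {A : ι → ℂ} {g : ι → E}
    (hA : Summable fun i => ‖A i‖) (h0 : ∀ u, ∑' i, A i * 𝐞 ⟪g i, u⟫_ℝ = 0) {c : E → ℂ}
    (hc : ∀ x, ‖c x‖ ≤ 1) : ∑' i, A i * c (g i) = 0 := by
  have hs : Summable fun i => A i * c (g i) := by
    refine hA.of_norm_bounded fun i => ?_
    rw [norm_mul]
    exact mul_le_of_le_one_right (norm_nonneg _) (hc _)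
  rw [← (hs.hasSum.tsum_fiberwise g).tsum_eq]
  have (y : E) : ∑' i : g ⁻¹' {y}, A i * c (g i) = 0 := by
    have he (i : g ⁻¹' {y}) : A i * c (g i) = A i * c y := by
      rw [show g i = y from i.2]
    simp only [he]
    rw [tsum_mul_right, tsum_fiber_eq_zero hA h0, zero_mul]
  simp [this]

end Uniqueness

/-! ### Rigidity of approximately linear integer valued functions. -/

section Rigidity

theorem differentiable_tsum_exp {ι : Type*} {a : ι → ℂ} {v : ι → ℝ} {C : ℝ}
    (ha : Summable fun i => ‖a i‖) (hv : ∀ i, |v i| ≤ C) :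
    Differentiable ℂ fun z : ℂ => ∑' i, a i * Complex.exp (2 * Real.pi * Complex.I * z * v i) := by
  intro z₀
  have hopen : IsOpen (Metric.ball (0 : ℂ) (‖z₀‖ + 1)) := Metric.isOpen_ball
  refine (Complex.differentiableOn_tsum_of_summable_norm
    (ha.mul_right (Real.exp (2 * Real.pi * (‖z₀‖ + 1) * C))) ?_ hopen ?_).differentiableAt
    (hopen.mem_nhds (by simp))
  · intro i
    fun_prop
  · intro i z hz
    rw [norm_mul]
    refine mul_le_mul_of_nonneg_left ?_ (norm_nonneg _)
    refine (Complex.norm_exp_le_exp_norm _).trans (Real.exp_le_exp.mpr ?_)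
    have hz' : ‖z‖ ≤ ‖z₀‖ + 1 := by
      have : ‖z‖ < ‖z₀‖ + 1 := by simpa using hz
      exact this.le
    simp only [norm_mul, Complex.norm_I, Complex.norm_real, Complex.norm_ofNat, mul_one,
      Real.norm_eq_abs, abs_of_pos Real.pi_pos]
    have := hv i
    have := Real.pi_pos
    gcongr

/-- Bounded `v` makes `F(τ) = ∑ a e(τ v)` entire. If `F(0) ≠ 0`, then `F` has no zeros near 0, hence
vanishes at points accumulating at 1, hence everywhere. -/
theorem tsum_eq_zero_of_mul_shift_eq_zero {ι : Type*} {a v : ι → ℝ} {C : ℝ} (ha : Summable a)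
    (hv : ∀ i, |v i| ≤ C)
    (h : ∀ τ : ℝ, (∑' i, (a i : ℂ) * 𝐞 (τ * v i)) * ∑' i, (a i : ℂ) * 𝐞 ((τ + 1) * v i) = 0) :
    ∑' i, a i = 0 := by
  by_contra hne
  have hasn : Summable fun x => ‖(a x : ℂ)‖ := by
    simpa only [Complex.norm_real] using ha.norm
  set F : ℂ → ℂ := fun z => ∑' x, (a x : ℂ) * Complex.exp (2 * Real.pi * Complex.I * z * v x)
    with hF
  have hFdiff : Differentiable ℂ F := differentiable_tsum_exp hasn hv
  have hFreal (τ : ℝ) : F τ = ∑' x, (a x : ℂ) * 𝐞 (τ * v x) := by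
    refine tsum_congr fun x => ?_
    rw [Real.fourierChar_apply]
    congr 2
    push_cast
    ring
  have hF0 : F 0 ≠ 0 := by
    have h3 := hFreal 0
    simp only [zero_mul, AddChar.map_zero_eq_one, Circle.coe_one, mul_one, Complex.ofReal_zero]
      at h3
    rwa [h3, ← Complex.ofReal_tsum, Complex.ofReal_ne_zero]
  have hseq : Tendsto (fun k : ℕ => ((1 / ((k : ℝ) + 1) : ℝ) : ℂ)) atTop (𝓝 0) := by
    have := (Complex.continuous_ofReal.tendsto 0).comp
      (tendsto_one_div_add_atTop_nhds_zero_nat (𝕜 := ℝ))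
    simpa only [Complex.ofReal_zero, Function.comp_def] using this
  have hev : ∀ᶠ k : ℕ in atTop, F ((1 / ((k : ℝ) + 1) + 1 : ℝ) : ℂ) = 0 := by
    filter_upwards [hseq.eventually (hFdiff.continuous.continuousAt.eventually_ne hF0)] with k hk
    exact (mul_eq_zero.mp (by rw [hFreal, hFreal]; exact h _)).resolve_left hk
  have hseq1 : Tendsto (fun k : ℕ => ((1 / ((k : ℝ) + 1) + 1 : ℝ) : ℂ)) atTop (𝓝[≠] 1) := by
    refine tendsto_nhdsWithin_iff.mpr ⟨?_, Eventually.of_forall fun k => ?_⟩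
    · have := hseq.add_const 1
      simpa only [Complex.ofReal_add, Complex.ofReal_one, zero_add] using this
    · have hk : (1 / ((k : ℝ) + 1) + 1) ≠ 1 := by
        have : 0 < 1 / ((k : ℝ) + 1) := by positivity
        linarith
      simpa only [Set.mem_compl_iff, Set.mem_singleton_iff, Complex.ofReal_eq_one] using hk
  have hzero := (hFdiff.differentiableOn.analyticOnNhd
    isOpen_univ).eqOn_zero_of_preconnected_of_frequently_eq_zero isPreconnected_univ
    (Set.mem_univ 1) (hseq1.frequently hev.frequently)
  exact hF0 (hzero (Set.mem_univ 0))

theorem fourierChar_intCast (k : ℤ) : 𝐞 (k : ℝ) = 1 := by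
  ext
  rw [Real.fourierChar_apply, Circle.coe_one, Complex.exp_eq_one_iff]
  exact ⟨k, by push_cast; ring⟩

variable {E : Type*} [NormedAddCommGroup E] [InnerProductSpace ℝ E] [FiniteDimensional ℝ E]
  [MeasurableSpace E] [BorelSpace E] {Λ S : Set E} {m : E → ℝ} {b : E → ℂ}

namespace PoissonPair

/-- By the Poisson formula this sum is a combination of the values `φ (s + u)`: it sees only the
part of S near `-u`. -/
theorem exists_mem_of_tsum_ne_zero (h : PoissonPair Λ S m b) {φ : E → ℂ} (h1 : ContDiff ℝ ∞ φ)
    (h2 : HasCompactSupport φ) {q : E → ℝ} (hq : ∀ x, 𝓕 φ x = q x) (x₀ u : E)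
    (hne : ∑' x : Λ, ((m x * q (x - x₀) : ℝ) : ℂ) * 𝐞 ⟪(x : E) - x₀, u⟫_ℝ ≠ 0) :
    ∃ s ∈ S, φ (s + u) ≠ 0 := by
  have h3 := h.poisson (fun w => 𝐞 ⟪w, x₀⟫_ℝ • (fun v => φ (v - -u)) w)
    (contDiff_modulate (h1.comp (contDiff_id.sub contDiff_const)) x₀)
    (hasCompactSupport_modulate (h2.comp_homeomorph (Homeomorph.subRight (-u))) x₀)
  by_contra hcon
  push Not at hcon
  refine hne ?_
  have hz : ∀ s : S, b s * (𝐞 ⟪(s : E), x₀⟫_ℝ • φ (s - -u)) = 0 := by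
    intro s
    rw [sub_neg_eq_add, hcon s s.2, smul_zero, mul_zero]
  rw [tsum_congr hz, tsum_zero] at h3
  rw [← h3]
  refine tsum_congr fun x => ?_
  rw [fourier_modulate, fourier_translate, hq, inner_neg_left, neg_neg, Circle.smul_def,
    smul_eq_mul, real_inner_comm]
  push_cast
  ring

/-- An integer valued additive function on `Λ - x₀` that is a bounded perturbation of a linear
functional of norm smaller than the separation of `S` is bounded. -/
theorem eq_zero_of_bounded (h : PoissonPair Λ S m b) {d : ℝ}
    (hS : S.Pairwise fun x y => d ≤ dist x y) {x₀ : E} (hx₀ : x₀ ∈ Λ) (f : E →+ ℝ) {y : E}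
    (hf : ∀ x ∈ Λ, ∃ k : ℤ, f (x - x₀) = k) {C : ℝ}
    (hC : ∀ x ∈ Λ, |f (x - x₀) - ⟪y, x - x₀⟫_ℝ| ≤ C) (hy : ‖y‖ < d) : y = 0 := by
  by_contra hy0
  have hypos : 0 < ‖y‖ := norm_pos_iff.mpr hy0
  -- If `s` and `s'` lie within `r` of `-u` and `y - u`, then `s - s' + y` has norm below `2 * r`.
  -- The first condition on `r` excludes `s = s'`, the second `s ≠ s'`.
  obtain ⟨r, hr, hr1, hr2⟩ : ∃ r : ℝ, 0 < r ∧ 2 * r ≤ ‖y‖ ∧ 2 * r + ‖y‖ ≤ d :=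
    ⟨min (‖y‖ / 2) ((d - ‖y‖) / 2), lt_min (by linarith) (by linarith),
      by linarith [min_le_left (‖y‖ / 2) ((d - ‖y‖) / 2)],
      by linarith [min_le_right (‖y‖ / 2) ((d - ‖y‖) / 2)]⟩
  obtain ⟨dΛ, hdΛ, hΛ⟩ := h.sep_left
  have : Countable Λ := (hΛ.countable_of_le_dist hdΛ).to_subtype
  obtain ⟨φ, q, h1, h2, hφ, hq, hq0, hq1⟩ := exists_fourier_nonneg (E := E) hr
  obtain ⟨K, hK, hKφ⟩ := exists_norm_fourier_le_decay h1 h2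
  have hqd (x : E) : |q x| ≤ K * decay x := by
    have := hKφ x
    rwa [hq, Complex.norm_real] at this
  set a : Λ → ℝ := fun x => m x * q (x - x₀) with ha
  have has : Summable a := h.summable_of_le_decay x₀ fun x => hqd _
  have hasn : Summable fun x => ‖(a x : ℂ)‖ := by
    simpa only [Complex.norm_real] using has.norm
  set v : Λ → ℝ := fun x => f (x - x₀) - ⟪y, (x : E) - x₀⟫_ℝ with hv
  -- Integrality of `f` enters here: shifting `u` by `-y` multiplies each term by `e(v x)`.
  have hchar (x : Λ) : 𝐞 (-⟪(x : E) - x₀, y⟫_ℝ) = 𝐞 (v x) := by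
    obtain ⟨k, hk⟩ := hf x x.2
    rw [hv]
    simp only
    rw [hk, sub_eq_add_neg (k : ℝ), AddChar.map_add_eq_mul, fourierChar_intCast, one_mul, real_inner_comm]
  have hprod (u : E) : (∑' x, (a x : ℂ) * 𝐞 ⟪(x : E) - x₀, u⟫_ℝ) *
      (∑' x, (a x : ℂ) * 𝐞 ⟪(x : E) - x₀, u - y⟫_ℝ) = 0 := by
    by_contra hne
    obtain ⟨s, hs, hφs⟩ := h.exists_mem_of_tsum_ne_zero h1 h2 hq x₀ u (left_ne_zero_of_mul hne)
    obtain ⟨s', hs', hφs'⟩ :=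
      h.exists_mem_of_tsum_ne_zero h1 h2 hq x₀ (u - y) (right_ne_zero_of_mul hne)
    have n1 := hφ _ hφs
    have n2 := hφ _ hφs'
    have n3 : ‖s - s' + y‖ < 2 * r := by
      have := norm_sub_le (s + u) (s' + (u - y))
      rw [show s + u - (s' + (u - y)) = s - s' + y by abel] at this
      linarith
    rcases eq_or_ne s s' with rfl | hss
    · rw [sub_self, zero_add] at n3
      linarith
    · have n4 : d ≤ dist s s' := hS hs hs' hss
      rw [dist_eq_norm] at n4
      have : ‖s - s'‖ ≤ ‖s - s' + y‖ + ‖y‖ := by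
        simpa using norm_sub_le (s - s' + y) y
      linarith
  -- The product is an exponential sum over `Λ × Λ` with frequencies `g p`. By additivity `v p.1 + v
  -- p.2` is a function of `g p`, so the character `e(⟪g p, u⟫)` may be replaced by `e(τ (v p.1 + v
  -- p.2))`.
  have hFprod (τ : ℝ) : (∑' x, (a x : ℂ) * 𝐞 (τ * v x)) *
      ∑' x, (a x : ℂ) * 𝐞 ((τ + 1) * v x) = 0 := by
    let A : Λ × Λ → ℂ := fun p => (a p.1 : ℂ) * ((a p.2 : ℂ) * 𝐞 (v p.2))
    let g : Λ × Λ → E := fun p => ((p.1 : E) - x₀) + ((p.2 : E) - x₀)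
    have hbn : Summable fun x => ‖(a x : ℂ) * 𝐞 (v x)‖ := by
      simpa only [norm_mul, Circle.norm_coe, mul_one] using hasn
    have hA : Summable fun p => ‖A p‖ :=
      Summable.mul_norm (f := fun x => (a x : ℂ)) (g := fun x => (a x : ℂ) * 𝐞 (v x)) hasn hbn
    have hchars (w : Λ → Circle) : Summable fun x => ‖(a x : ℂ) * w x‖ := by
      simpa only [norm_mul, Circle.norm_coe, mul_one] using hasn
    have hchars' (w : Λ → Circle) : Summable fun x => ‖(a x : ℂ) * 𝐞 (v x) * w x‖ := by
      simpa only [norm_mul, Circle.norm_coe, mul_one] using hasn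
    have h0 (u : E) : ∑' p, A p * 𝐞 ⟪g p, u⟫_ℝ = 0 := by
      rw [← hprod u]
      have e1 : ∑' x, (a x : ℂ) * 𝐞 ⟪(x : E) - x₀, u - y⟫_ℝ =
          ∑' x, (a x : ℂ) * 𝐞 (v x) * 𝐞 ⟪(x : E) - x₀, u⟫_ℝ := by
        refine tsum_congr fun x => ?_
        rw [inner_sub_right, sub_eq_add_neg, AddChar.map_add_eq_mul, hchar, Circle.coe_mul]
        ring
      rw [e1, tsum_mul_tsum_of_summable_norm (hchars fun x => 𝐞 ⟪(x : E) - x₀, u⟫_ℝ)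
        (hchars' fun x => 𝐞 ⟪(x : E) - x₀, u⟫_ℝ)]
      refine tsum_congr fun p => ?_
      simp only [A, g]
      rw [inner_add_left, AddChar.map_add_eq_mul, Circle.coe_mul]
      ring
    have := tsum_mul_eq_zero_of_forall_fourierChar hA h0
      (c := fun z => 𝐞 (τ * (f z - ⟪y, z⟫_ℝ))) (fun z => (Circle.norm_coe _).le)
    rw [← this, tsum_mul_tsum_of_summable_norm (hchars fun x => 𝐞 (τ * v x))
      (hchars fun x => 𝐞 ((τ + 1) * v x))]
    refine tsum_congr fun p => ?_
    simp only [A, g, map_add, inner_add_right]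
    rw [show τ * (f ((p.1 : E) - x₀) + f ((p.2 : E) - x₀) -
      (⟪y, (p.1 : E) - x₀⟫_ℝ + ⟪y, (p.2 : E) - x₀⟫_ℝ)) = τ * v p.1 + τ * v p.2 by
        simp only [hv]; ring, add_mul, one_mul, AddChar.map_add_eq_mul, AddChar.map_add_eq_mul,
      Circle.coe_mul, Circle.coe_mul]
    ring
  have h4 := has.le_tsum ⟨x₀, hx₀⟩ fun x _ => mul_nonneg (h.pos x x.2).le (hq0 _)
  rw [tsum_eq_zero_of_mul_shift_eq_zero has (fun x => hC x x.2) hFprod] at h4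
  simp only [ha, sub_self, hq1, mul_one] at h4
  exact absurd (h.pos _ hx₀) (not_lt.mpr h4)

end PoissonPair

end Rigidity

/-! ### Approximately additive functions. -/

section QuasiAdditive

variable {E : Type*} [NormedAddCommGroup E] [InnerProductSpace ℝ E]

/-- Hyers' theorem. -/
theorem exists_addMonoidHom_of_abs_sub_le {g : E → ℝ} {M : ℝ}
    (hg : ∀ u v, |g (u + v) - g u - g v| ≤ M) : ∃ A : E →+ ℝ, ∀ u, |g u - A u| ≤ M := by
  set s : E → ℕ → ℝ := fun u k => g ((2 : ℝ) ^ k • u) / 2 ^ k with hs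
  have hstep (u : E) (k : ℕ) : dist (s u k) (s u (k + 1)) ≤ M / 2 / 2 ^ k := by
    have h1 := hg ((2 : ℝ) ^ k • u) ((2 : ℝ) ^ k • u)
    rw [← two_smul ℝ ((2 : ℝ) ^ k • u), smul_smul, ← pow_succ'] at h1
    have h2 : s u k - s u (k + 1) = -(g ((2 : ℝ) ^ (k + 1) • u) - g ((2 : ℝ) ^ k • u) -
        g ((2 : ℝ) ^ k • u)) / 2 ^ (k + 1) := by
      simp only [hs]
      rw [pow_succ (2 : ℝ) k]
      field_simp
      ring
    rw [Real.dist_eq, h2, abs_div, abs_neg, abs_of_pos (by positivity : (0 : ℝ) < 2 ^ (k + 1)),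
      div_div, ← pow_succ']
    gcongr
  have hlim (u : E) : ∃ a, Tendsto (s u) atTop (𝓝 a) :=
    cauchySeq_tendsto_of_complete (cauchySeq_of_le_geometric_two (hstep u))
  choose A hA using hlim
  have hadd (u v : E) : A (u + v) = A u + A v := by
    have h1 : Tendsto (fun k => s (u + v) k - s u k - s v k) atTop (𝓝 (A (u + v) - A u - A v)) :=
      ((hA _).sub (hA _)).sub (hA _)
    have h2 : Tendsto (fun k : ℕ => M / 2 ^ k) atTop (𝓝 0) := by
      have := (tendsto_pow_atTop_nhds_zero_of_lt_one (r := (1 / 2 : ℝ)) (by norm_num)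
        (by norm_num)).const_mul M
      simpa [div_eq_mul_inv] using this
    have h3 : Tendsto (fun k => s (u + v) k - s u k - s v k) atTop (𝓝 0) := by
      refine squeeze_zero_norm (fun k => ?_) h2
      have h4 := hg ((2 : ℝ) ^ k • u) ((2 : ℝ) ^ k • v)
      rw [← smul_add] at h4
      simp only [hs]
      rw [← sub_div, ← sub_div, Real.norm_eq_abs, abs_div,
        abs_of_pos (by positivity : (0 : ℝ) < 2 ^ k)]
      gcongr
    have := tendsto_nhds_unique h1 h3
    linarith
  refine ⟨AddMonoidHom.mk' A hadd, fun u => ?_⟩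
  have := dist_le_of_le_geometric_two_of_tendsto₀ (hstep u) (hA u)
  simpa [hs, Real.dist_eq] using this

theorem AddMonoidHom.exists_eq_inner [FiniteDimensional ℝ E] (A : E →+ ℝ) {M : ℝ}
    (hA : ∀ u, ‖u‖ ≤ 1 → |A u| ≤ M) : ∃ y : E, ∀ u, A u = ⟪y, u⟫_ℝ := by
  have hc : Continuous A := by
    refine A.continuous_of_isBounded_nhds_zero (Metric.closedBall_mem_nhds 0 one_pos) ?_
    refine (Metric.isBounded_closedBall (x := (0 : ℝ)) (r := M)).subset ?_
    rintro _ ⟨u, hu, rfl⟩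
    rw [mem_closedBall_zero_iff] at hu ⊢
    exact hA u hu
  refine ⟨(InnerProductSpace.toDual ℝ E).symm (A.toRealLinearMap hc), fun u => ?_⟩
  rw [InnerProductSpace.toDual_symm_apply]
  rfl

end QuasiAdditive

/-! ### Meyer sets: linear approximation and finite generation. -/

section Meyer

section

variable {E : Type*} [NormedAddCommGroup E] {Λ : Set E} {R : ℝ}

theorem Set.Finite.exists_abs_le {α : Type*} {s : Set α} (hs : s.Finite) (f : α → ℝ) :
    ∃ B : ℝ, 0 ≤ B ∧ ∀ x ∈ s, |f x| ≤ B := by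
  obtain ⟨B, hB⟩ := (hs.image fun x => |f x|).bddAbove
  exact ⟨max B 0, le_max_right _ _, fun x hx => (hB ⟨x, hx, rfl⟩).trans (le_max_left _ _)⟩

/-- Relative density at `t = 0`: every difference recurs with its base point within `R` of the
origin. This is the Meyer property, with finitely many `z` when Λ is locally finite. -/
theorem exists_sub_eq_sub (hR : ∀ a t : E, (∃ x ∈ Λ, x + a ∈ Λ) → ∃ x ∈ Λ, ‖x - t‖ ≤ R ∧ x + a ∈ Λ)
    {p q : E} (hp : p ∈ Λ) (hq : q ∈ Λ) : ∃ x ∈ Λ, ∃ z ∈ Λ, ‖z‖ ≤ R ∧ q - p = x - z := by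
  obtain ⟨z, hz, hzR, hza⟩ := hR (q - p) 0 ⟨p, hp, by simpa using hq⟩
  exact ⟨z + (q - p), hza, z, hz, by simpa using hzR, by abel⟩

theorem exists_mem_norm_sub_le
    (hR : ∀ a t : E, (∃ x ∈ Λ, x + a ∈ Λ) → ∃ x ∈ Λ, ‖x - t‖ ≤ R ∧ x + a ∈ Λ)
    {x₀ : E} (hx₀ : x₀ ∈ Λ) (t : E) : ∃ x ∈ Λ, ‖x - t‖ ≤ R := by
  obtain ⟨x, hx, hxt, -⟩ := hR 0 t ⟨x₀, hx₀, by simpa using hx₀⟩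
  exact ⟨x, hx, hxt⟩

end

variable {E : Type*} [NormedAddCommGroup E] [InnerProductSpace ℝ E] {Λ : Set E} {R : ℝ}

/-- Every additive function is a bounded perturbation of a linear one on a Meyer set. -/
theorem exists_inner_approx [FiniteDimensional ℝ E]
    (hΛ : ∀ r : ℝ, (Λ ∩ Metric.closedBall 0 r).Finite)
    (hR : ∀ a t : E, (∃ x ∈ Λ, x + a ∈ Λ) → ∃ x ∈ Λ, ‖x - t‖ ≤ R ∧ x + a ∈ Λ)
    {x₀ : E} (hx₀ : x₀ ∈ Λ) (f : E →+ ℝ) :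
    ∃ (y : E) (C : ℝ), ∀ x ∈ Λ, |f (x - x₀) - ⟪y, x - x₀⟫_ℝ| ≤ C := by
  have hnear := exists_mem_norm_sub_le hR hx₀
  have hR0 : 0 ≤ R := by
    obtain ⟨x, -, hx⟩ := hnear 0
    exact (norm_nonneg _).trans hx
  obtain ⟨B, hB0, hB⟩ := (hΛ (5 * R + ‖x₀‖ + 1)).exists_abs_le f
  have hB' (x : E) (hx : x ∈ Λ) (hxn : ‖x‖ ≤ 5 * R + ‖x₀‖ + 1) : |f x| ≤ B :=
    hB x ⟨hx, by simpa using hxn⟩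
  have hx₀n := norm_nonneg x₀
  -- Sampling `f` at a point of Λ near `x₀ + u` extends it to an approximately additive function on
  -- `E`.
  choose X hXΛ hX using fun u : E => hnear (u + x₀)
  obtain ⟨A, hA⟩ := exists_addMonoidHom_of_abs_sub_le (g := fun u => f (X u - x₀))
    (M := 4 * B) (by
    intro u v
    obtain ⟨p, hp, z, hz, hzR, h1⟩ := exists_sub_eq_sub hR (hXΛ u) (hXΛ (u + v))
    obtain ⟨p', hp', z', hz', hzR', h2⟩ := exists_sub_eq_sub hR (hXΛ v) hp
    have h3 : X (u + v) - x₀ - (X u - x₀) - (X v - x₀) = p' - z' - z + x₀ := by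
      have : X (u + v) - x₀ - (X u - x₀) - (X v - x₀) = (X (u + v) - X u) - X v + x₀ := by abel
      rw [this, h1]
      have : p - z - X v + x₀ = (p - X v) - z + x₀ := by abel
      rw [this, h2]
    -- Two Meyer reductions express the additivity defect by `p'`, `z'`, `z`, `x₀`. Three
    -- approximation errors and the two short vectors give `5 * R`, so all four range over a finite
    -- set.
    have h4 : ‖p'‖ ≤ 5 * R + ‖x₀‖ := by
      have e : p' = (X (u + v) - (u + v + x₀)) - (X u - (u + x₀)) - (X v - (v + x₀)) +
          z' + z - x₀ := by
        have : p' = (p' - z' - z + x₀) + z' + z - x₀ := by abel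
        rw [this, ← h3]
        abel
      have n1 := hX (u + v)
      have n2 := hX u
      have n3 := hX v
      rw [e]
      refine (norm_sub_le _ _).trans ?_
      have m1 := norm_add_le ((X (u + v) - (u + v + x₀)) - (X u - (u + x₀)) -
        (X v - (v + x₀)) + z') z
      have m2 := norm_add_le ((X (u + v) - (u + v + x₀)) - (X u - (u + x₀)) -
        (X v - (v + x₀))) z'
      have m3 := norm_sub_le ((X (u + v) - (u + v + x₀)) - (X u - (u + x₀))) (X v - (v + x₀))
      have m4 := norm_sub_le (X (u + v) - (u + v + x₀)) (X u - (u + x₀))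
      linarith
    have h5 : f (X (u + v) - x₀) - f (X u - x₀) - f (X v - x₀) = f p' - f z' - f z + f x₀ := by
      rw [← map_sub, ← map_sub, h3, map_add, map_sub, map_sub]
    rw [h5]
    have b1 := hB' p' hp' (by linarith)
    have b2 := hB' z' hz' (by linarith)
    have b3 := hB' z hz (by linarith)
    have b4 := hB' x₀ hx₀ (by linarith)
    rw [abs_le] at *
    constructor <;> linarith)
  have hAb : ∀ u, ‖u‖ ≤ 1 → |A u| ≤ 6 * B := by
    intro u hu
    have b1 := hB' (X u) (hXΛ u) (by
      have : X u = (X u - (u + x₀)) + u + x₀ := by abel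
      rw [this]
      have m1 := norm_add_le ((X u - (u + x₀)) + u) x₀
      have m2 := norm_add_le (X u - (u + x₀)) u
      have := hX u
      linarith)
    have b2 := hB' x₀ hx₀ (by linarith)
    have b3 := hA u
    rw [map_sub] at b3
    rw [abs_le] at *
    constructor <;> linarith
  obtain ⟨y, hy⟩ := A.exists_eq_inner hAb
  refine ⟨y, 6 * B, fun x hx => ?_⟩
  rw [← hy]
  have b1 := hA (x - x₀)
  obtain ⟨p, hp, z, hz, hzR, h1⟩ := exists_sub_eq_sub hR (hXΛ (x - x₀)) hx
  have h2 : f x - f (X (x - x₀)) = f p - f z := by rw [← map_sub, h1, map_sub]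
  have h3 := hX (x - x₀)
  rw [sub_add_cancel] at h3
  have b2 := hB' p hp (by
    have : p = -(X (x - x₀) - x) + z := by rw [neg_sub, h1]; abel
    rw [this]
    refine (norm_add_le _ _).trans ?_
    rw [norm_neg]
    linarith)
  have b3 := hB' z hz (by linarith)
  simp only [map_sub] at *
  rw [abs_le] at *
  constructor <;> linarith

/-- Λ has a point within `R` of `x₀ + τ • w`; `τ` is chosen so that the inner product there is at
least `C + 1`. -/
theorem eq_zero_of_abs_inner_le
    (hR : ∀ a t : E, (∃ x ∈ Λ, x + a ∈ Λ) → ∃ x ∈ Λ, ‖x - t‖ ≤ R ∧ x + a ∈ Λ)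
    {x₀ : E} (hx₀ : x₀ ∈ Λ) {w : E} {C : ℝ} (hC : ∀ x ∈ Λ, |⟪w, x - x₀⟫_ℝ| ≤ C) : w = 0 := by
  by_contra hw
  have hw0 : 0 < ‖w‖ := norm_pos_iff.mpr hw
  set τ : ℝ := (C + R * ‖w‖ + 1) / ‖w‖ ^ 2 with hτ
  obtain ⟨x, hx, hxR⟩ := exists_mem_norm_sub_le hR hx₀ (x₀ + τ • w)
  have h1 : ⟪w, x - x₀⟫_ℝ = τ * ‖w‖ ^ 2 + ⟪w, x - (x₀ + τ • w)⟫_ℝ := by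
    rw [show x - x₀ = τ • w + (x - (x₀ + τ • w)) by abel, inner_add_right, inner_smul_right,
      real_inner_self_eq_norm_sq]
  have h2 : τ * ‖w‖ ^ 2 = C + R * ‖w‖ + 1 := by
    rw [hτ]
    field_simp
  have h3 := abs_real_inner_le_norm w (x - (x₀ + τ • w))
  have h4 : ‖w‖ * ‖x - (x₀ + τ • w)‖ ≤ ‖w‖ * R := by gcongr
  have h5 := hC x hx
  rw [abs_le] at h3 h5
  linarith

/-- Any point of Λ is joined to `x₀` by a chain in Λ of steps at most `2 * R + 1`: moving `R + 1`
towards `x₀` and correcting by at most `R` gains at least 1. By the Meyer property such steps are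
differences of points of norm at most `(2 * R + 1) + R`. -/
theorem exists_finite_span (hΛ : ∀ r : ℝ, (Λ ∩ Metric.closedBall 0 r).Finite)
    (hR : ∀ a t : E, (∃ x ∈ Λ, x + a ∈ Λ) → ∃ x ∈ Λ, ‖x - t‖ ≤ R ∧ x + a ∈ Λ)
    {x₀ : E} (hx₀ : x₀ ∈ Λ) :
    ∃ s : Set E, s.Finite ∧ ∀ x ∈ Λ, x - x₀ ∈ Submodule.span ℤ s := by
  have hnear := exists_mem_norm_sub_le hR hx₀
  have hR0 : 0 ≤ R := by
    obtain ⟨x, -, hx⟩ := hnear 0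
    exact (norm_nonneg _).trans hx
  set s : Set E := Set.image2 (fun x z => x - z) (Λ ∩ Metric.closedBall 0 (3 * R + 1))
    (Λ ∩ Metric.closedBall 0 (3 * R + 1)) with hs
  have hstep (p q : E) (hp : p ∈ Λ) (hq : q ∈ Λ) (hpq : ‖q - p‖ ≤ 2 * R + 1) :
      q - p ∈ Submodule.span ℤ s := by
    obtain ⟨x, hx, z, hz, hzR, h1⟩ := exists_sub_eq_sub hR hp hq
    refine Submodule.subset_span ⟨x, ⟨hx, ?_⟩, z, ⟨hz, ?_⟩, h1.symm⟩
    · rw [mem_closedBall_zero_iff]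
      have : x = (q - p) + z := by rw [h1]; abel
      rw [this]
      linarith [norm_add_le (q - p) z]
    · rw [mem_closedBall_zero_iff]
      linarith
  refine ⟨s, (hΛ _).image2 _ (hΛ _), ?_⟩
  have hind (k : ℕ) : ∀ x ∈ Λ, ‖x - x₀‖ ≤ 2 * R + 1 + k → x - x₀ ∈ Submodule.span ℤ s := by
    induction k with
    | zero => exact fun x hx hxk => hstep x₀ x hx₀ hx (by simpa using hxk)
    | succ k ih =>
      intro x hx hxk
      rcases le_or_gt ‖x - x₀‖ (2 * R + 1) with hle | hgt
      · exact hstep x₀ x hx₀ hx hle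
      have hn : 0 < ‖x - x₀‖ := by linarith
      set c : ℝ := (R + 1) / ‖x - x₀‖ with hc
      have hcn : c * ‖x - x₀‖ = R + 1 := div_mul_cancel₀ _ hn.ne'
      have hc0 : 0 ≤ c := by positivity
      have hc1 : c ≤ 1 := by
        rw [hc, div_le_one hn]
        linarith
      obtain ⟨x', hx', hx'R⟩ := hnear (x - c • (x - x₀))
      have h1 : ‖x' - x₀‖ ≤ 2 * R + 1 + k := by
        have e : x' - x₀ = (x' - (x - c • (x - x₀))) + (1 - c) • (x - x₀) := by
          rw [sub_smul, one_smul]; abel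
        have : ‖(1 - c) • (x - x₀)‖ = ‖x - x₀‖ - (R + 1) := by
          rw [norm_smul, Real.norm_eq_abs, abs_of_nonneg (by linarith), sub_mul, one_mul, hcn]
        rw [e]
        refine (norm_add_le _ _).trans ?_
        push_cast at hxk
        linarith
      have h2 : ‖x - x'‖ ≤ 2 * R + 1 := by
        have e : x - x' = c • (x - x₀) - (x' - (x - c • (x - x₀))) := by abel
        have : ‖c • (x - x₀)‖ = R + 1 := by
          rw [norm_smul, Real.norm_eq_abs, abs_of_nonneg hc0, hcn]
        rw [e]
        refine (norm_sub_le _ _).trans ?_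
        linarith
      have := add_mem (hstep x' x hx' hx h2) (ih x' hx' h1)
      rwa [sub_add_sub_cancel] at this
  intro x hx
  obtain ⟨k, hk⟩ := exists_nat_ge ‖x - x₀‖
  exact hind k x hx (by linarith)

/-- A finitely generated torsion-free group is free. Its coordinates extend to `E` by linear algebra
over ℚ; the resulting additive functions need not be continuous. -/
theorem exists_integer_coordinates {s : Set E} (hs : s.Finite) :
    ∃ (N : ℕ) (g : Fin N → E) (f : Fin N → E →+ ℝ), ∀ x ∈ Submodule.span ℤ s,
      ∃ k : Fin N → ℤ, x = ∑ j, (k j : ℝ) • g j ∧ ∀ j, f j x = k j := by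
  let _ : Module ℚ E := Module.compHom E (algebraMap ℚ ℝ)
  have : Module.Finite ℤ (Submodule.span ℤ s) := Module.Finite.span_of_finite ℤ hs
  have : IsAddTorsionFree E := .of_module_rat _
  let B := Module.finBasis ℤ (Submodule.span ℤ s)
  let g : Fin (Module.finrank ℤ (Submodule.span ℤ s)) → E := fun j => B j
  have hgZ : LinearIndependent ℤ g :=
    B.linearIndependent.map' (Submodule.span ℤ s).subtype (Submodule.ker_subtype _)
  have hgQ : LinearIndependent ℚ g := (LinearIndependent.iff_fractionRing ℤ ℚ).mp hgZ
  obtain ⟨Φ, hΦ⟩ := LinearMap.exists_extend hgQ.repr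
  let f : Fin (Module.finrank ℤ (Submodule.span ℤ s)) → E →+ ℝ := fun j =>
    { toFun := fun x => ((Φ x j : ℚ) : ℝ)
      map_zero' := by simp
      map_add' := by intro x y; simp }
  have hfg (i j) : f j (g i) = if i = j then 1 else 0 := by
    have h1 : Φ (g i) = Finsupp.single i 1 := by
      have h2 := LinearMap.congr_fun hΦ ⟨g i, Submodule.subset_span ⟨i, rfl⟩⟩
      rw [hgQ.repr_eq_single i ⟨g i, Submodule.subset_span ⟨i, rfl⟩⟩ rfl] at h2
      exact h2
    change ((Φ (g i) j : ℚ) : ℝ) = _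
    rw [h1, Finsupp.single_apply]
    split_ifs <;> simp
  refine ⟨_, g, f, fun x hx => ⟨fun j => B.repr ⟨x, hx⟩ j, ?_, fun j => ?_⟩⟩
  · have := congrArg Subtype.val (B.sum_repr ⟨x, hx⟩)
    simp only [Submodule.coe_sum, Submodule.coe_smul_of_tower] at this
    refine this.symm.trans ?_
    exact Finset.sum_congr rfl fun j _ => (Int.cast_smul_eq_zsmul ℝ _ _).symm
  · have := congrArg Subtype.val (B.sum_repr ⟨x, hx⟩)
    simp only [Submodule.coe_sum, Submodule.coe_smul_of_tower] at this
    have h2 : f j x = f j (∑ i, B.repr ⟨x, hx⟩ i • g i) := by rw [this]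
    rw [h2, map_sum]
    simp only [map_zsmul, hfg]
    simp

end Meyer

/-! ### Construction of the lattice. -/

section LatticeCover

theorem discreteTopology_of_norm_lt {E : Type*} [NormedAddCommGroup E] {P : Submodule ℤ E} {δ : ℝ} (hδ : 0 < δ)
    (h : ∀ p ∈ P, ‖p‖ < δ → p = 0) : DiscreteTopology P := by
  refine discreteTopology_iff_isOpen_singleton_zero.mpr ⟨Metric.ball 0 δ, Metric.isOpen_ball, ?_⟩
  ext p
  simp only [Set.mem_preimage, mem_ball_zero_iff, Set.mem_singleton_iff]
  refine ⟨fun hp => Subtype.ext (h p p.2 hp), ?_⟩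
  rintro rfl
  simpa using hδ

variable {E : Type*} [NormedAddCommGroup E] [InnerProductSpace ℝ E] {Λ : Set E} {R : ℝ}

/-- A family dual to a basis, as a basis. -/
theorem exists_basis_of_inner_eq {ι : Type*} [Finite ι] [DecidableEq ι] (p : Module.Basis ι ℝ E)
    {l : ι → E} (h : ∀ i j, ⟪p i, l j⟫_ℝ = if i = j then 1 else 0) :
    ∃ q : Module.Basis ι ℝ E, ⇑q = l := by
  cases nonempty_fintype ι
  have hli : LinearIndependent ℝ l := by
    rw [Fintype.linearIndependent_iff]
    intro c hc i
    have := congrArg (fun z => ⟪p i, z⟫_ℝ) hc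
    simpa [inner_sum, inner_smul_right, h] using this
  rcases isEmpty_or_nonempty ι with hι | hι
  · exact ⟨p, funext fun i => isEmptyElim i⟩
  · exact ⟨basisOfLinearIndependentOfCardEqFinrank hli (Module.finrank_eq_card_basis p).symm,
      coe_basisOfLinearIndependentOfCardEqFinrank _ _⟩

/-- A Meyer set for which no small nonzero vector is the linear part of an integer valued additive
function is contained in a finite union of translates of a lattice. -/
theorem exists_lattice_cover [FiniteDimensional ℝ E]
    (hΛ : ∀ r : ℝ, (Λ ∩ Metric.closedBall 0 r).Finite)
    (hR : ∀ a t : E, (∃ x ∈ Λ, x + a ∈ Λ) → ∃ x ∈ Λ, ‖x - t‖ ≤ R ∧ x + a ∈ Λ)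
    {x₀ : E} (hx₀ : x₀ ∈ Λ) {δ : ℝ} (hδ : 0 < δ)
    (hrigid : ∀ (f : E →+ ℝ) (y : E) (C : ℝ), (∀ x ∈ Λ, ∃ k : ℤ, f (x - x₀) = k) →
      (∀ x ∈ Λ, |f (x - x₀) - ⟪y, x - x₀⟫_ℝ| ≤ C) → ‖y‖ < δ → y = 0) :
    ∃ (ι : Type) (_ : Fintype ι) (l : Module.Basis ι ℝ E) (F : Finset E),
      Λ ⊆ ⋃ θ ∈ F, θ +ᵥ (Submodule.span ℤ (Set.range l) : Set E) := by
  classical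
  obtain ⟨s, hs, hspan⟩ := exists_finite_span hΛ hR hx₀
  obtain ⟨N, g, f, hgf⟩ := exists_integer_coordinates hs
  choose y C hyC using fun j => exists_inner_approx hΛ hR hx₀ (f j)
  -- recovering a vector from its inner products with the generators
  have hrec (u : E) : u = ∑ j, ⟪u, g j⟫_ℝ • y j := by
    -- Since `x - x₀ = ∑ k j • g j` with `k j = f j (x - x₀)`, pairing the difference with `x - x₀`
    -- leaves a combination of bounded errors.
    refine sub_eq_zero.mp (eq_zero_of_abs_inner_le hR hx₀ (C := ∑ j, |⟪u, g j⟫_ℝ| * C j) ?_)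
    intro x hx
    obtain ⟨k, hk, hfk⟩ := hgf _ (hspan x hx)
    have h1 : ⟪u - ∑ j, ⟪u, g j⟫_ℝ • y j, x - x₀⟫_ℝ =
        ∑ j, ⟪u, g j⟫_ℝ * (f j (x - x₀) - ⟪y j, x - x₀⟫_ℝ) := by
      simp only [mul_sub, Finset.sum_sub_distrib, inner_sub_left, sum_inner, inner_smul_left,
        hfk]
      congr 1
      conv_lhs => rw [hk]
      simp [inner_sum, inner_smul_right, mul_comm]
    rw [h1]
    refine (Finset.abs_sum_le_sum_abs _ _).trans (Finset.sum_le_sum fun j _ => ?_)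
    rw [abs_mul]
    exact mul_le_mul_of_nonneg_left (hyC j x hx) (abs_nonneg _)
  set P : Submodule ℤ E := Submodule.span ℤ (Set.range y) with hP
  have hPd : DiscreteTopology P := by
    refine discreteTopology_of_norm_lt hδ fun p hp hpδ => ?_
    obtain ⟨c, hc⟩ := (Submodule.mem_span_range_iff_exists_fun ℤ).mp hp
    -- An integer combination of the `y j` is the linear part of the same combination of the `f j`.
    refine hrigid (∑ j, c j • f j) p (∑ j, |(c j : ℝ)| * C j) ?_ ?_ hpδ
    · intro x hx
      obtain ⟨k, -, hfk⟩ := hgf _ (hspan x hx)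
      refine ⟨∑ j, c j * k j, ?_⟩
      simp [AddMonoidHom.finsetSum_apply, hfk]
    · intro x hx
      have h1 : (∑ j, c j • f j) (x - x₀) - ⟪p, x - x₀⟫_ℝ =
          ∑ j, (c j : ℝ) * (f j (x - x₀) - ⟪y j, x - x₀⟫_ℝ) := by
        rw [← hc]
        simp only [← Int.cast_smul_eq_zsmul ℝ, sum_inner, inner_smul_left, mul_sub,
          Finset.sum_sub_distrib, AddMonoidHom.finsetSum_apply, AddMonoidHom.smul_apply]
        simp
      rw [h1]
      refine (Finset.abs_sum_le_sum_abs _ _).trans (Finset.sum_le_sum fun j _ => ?_)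
      rw [abs_mul]
      exact mul_le_mul_of_nonneg_left (hyC j x hx) (abs_nonneg _)
  have hPl : IsZLattice ℝ P := by
    refine ⟨eq_top_iff.mpr fun u _ => ?_⟩
    rw [hrec u]
    exact Submodule.sum_mem _ fun j _ => Submodule.smul_mem _ _
      (Submodule.subset_span (Submodule.subset_span ⟨j, rfl⟩))
  have : Module.Finite ℤ P := ZLattice.module_finite ℝ P
  have : Module.Free ℤ P := ZLattice.module_free ℝ P
  let pZ := Module.finBasis ℤ P
  let p := pZ.ofZLatticeBasis ℝ P
  have hpmem (i) : p i ∈ P := by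
    rw [Module.Basis.ofZLatticeBasis_apply]
    exact (pZ i).2
  have hyP (j) : y j ∈ P := Submodule.subset_span ⟨j, rfl⟩
  let n : Fin N → Fin (Module.finrank ℤ P) → ℤ := fun j i => pZ.repr ⟨y j, hyP j⟩ i
  have hn (j) : y j = ∑ i, (n j i : ℝ) • p i := by
    have := congrArg Subtype.val (pZ.sum_repr ⟨y j, hyP j⟩)
    simp only [Submodule.coe_sum, Submodule.coe_smul_of_tower] at this
    refine this.symm.trans (Finset.sum_congr rfl fun i _ => ?_)
    rw [Module.Basis.ofZLatticeBasis_apply, Int.cast_smul_eq_zsmul]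
  choose K hK using fun i => (Submodule.mem_span_range_iff_exists_fun ℤ).mp (hpmem i)
  -- Expanding `hrec (p k)` in the basis `p` shows that these vectors are dual to `p`.
  let l : Fin (Module.finrank ℤ P) → E := fun i => ∑ j, (n j i : ℝ) • g j
  have hdual (k i) : ⟪p k, l i⟫_ℝ = if k = i then 1 else 0 := by
    have h1 : p k = ∑ i, ⟪p k, l i⟫_ℝ • p i := by
      conv_lhs => rw [hrec (p k)]
      simp only [hn, l, inner_sum, inner_smul_right, Finset.smul_sum, Finset.sum_smul, smul_smul]
      rw [Finset.sum_comm]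
      refine Finset.sum_congr rfl fun i _ => Finset.sum_congr rfl fun j _ => ?_
      rw [mul_comm]
    have h2 := congrArg (fun z => p.repr z i) h1
    simp only [map_sum, map_smul, Module.Basis.repr_self, Finsupp.coe_finsetSum, Finset.sum_apply,
      Finsupp.smul_apply, Finsupp.single_apply, smul_eq_mul, mul_ite, mul_one, mul_zero,
      Finset.sum_ite_eq', Finset.mem_univ, if_true] at h2
    exact h2.symm
  obtain ⟨lb, hlb⟩ := exists_basis_of_inner_eq p hdual
  -- the integer valued bounded part of the coordinates
  let c : Fin N → Fin N → ℤ := fun j j' => (if j = j' then 1 else 0) - ∑ i, n j i * K i j'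
  have hc0 (j) : ∑ j', (c j j' : ℝ) • y j' = 0 := by
    simp only [c, Int.cast_sub, sub_smul, Finset.sum_sub_distrib, Int.cast_sum, Int.cast_mul,
      Finset.sum_smul, Int.cast_ite, Int.cast_one, Int.cast_zero, ite_smul, one_smul, zero_smul,
      Finset.sum_ite_eq, Finset.mem_univ, if_true]
    rw [Finset.sum_comm, sub_eq_zero]
    conv_lhs => rw [hn j]
    refine Finset.sum_congr rfl fun i _ => ?_
    rw [← hK i, Finset.smul_sum]
    refine Finset.sum_congr rfl fun j' _ => ?_
    rw [mul_smul, Int.cast_smul_eq_zsmul ℝ (K i j')]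
  let B : Fin N → ℝ := fun j => ∑ j', |(c j j' : ℝ)| * C j'
  let box : Finset (Fin N → ℤ) := Fintype.piFinset fun j => Finset.Icc (-⌈B j⌉) ⌈B j⌉
  refine ⟨_, inferInstance, lb, box.image fun k => x₀ + ∑ j, (k j : ℝ) • g j, fun x hx => ?_⟩
  obtain ⟨k, hk, hfk⟩ := hgf _ (hspan x hx)
  -- By `hc0` the linear parts cancel, leaving only errors bounded by `B`; being integral, `k'`
  -- takes finitely many values. The remainder `k - k'` contributes an element of the span of `l`.
  let k' : Fin N → ℤ := fun j => ∑ j', c j j' * k j'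
  have hk' (j) : |(k' j : ℝ)| ≤ B j := by
    have h1 : (k' j : ℝ) = ∑ j', (c j j' : ℝ) * (f j' (x - x₀) - ⟪y j', x - x₀⟫_ℝ) := by
      have h2 := congrArg (fun z => ⟪z, x - x₀⟫_ℝ) (hc0 j)
      simp only [sum_inner, inner_smul_left, inner_zero_left, conj_trivial] at h2
      simp only [mul_sub, Finset.sum_sub_distrib, h2, hfk, k']
      simp
    rw [h1]
    refine (Finset.abs_sum_le_sum_abs _ _).trans (Finset.sum_le_sum fun j' _ => ?_)
    rw [abs_mul]
    exact mul_le_mul_of_nonneg_left (hyC j' x hx) (abs_nonneg _)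
  have hbox : k' ∈ box := by
    refine Fintype.mem_piFinset.mpr fun j => Finset.mem_Icc.mpr ?_
    have h1 := abs_le.mp (hk' j)
    have h2 := Int.le_ceil (B j)
    constructor
    · have : (-(⌈B j⌉ : ℝ)) ≤ k' j := by linarith
      exact_mod_cast this
    · have : (k' j : ℝ) ≤ ⌈B j⌉ := by linarith
      exact_mod_cast this
  have hdecomp : x = (x₀ + ∑ j, (k' j : ℝ) • g j) + ∑ i, (∑ j', K i j' * k j') • l i := by
    have h1 (j) : k j = k' j + ∑ i, n j i * ∑ j', K i j' * k j' := by
      simp only [k', c, sub_mul, Finset.sum_sub_distrib, ite_mul, one_mul, zero_mul,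
        Finset.sum_ite_eq, Finset.mem_univ, if_true, Finset.sum_mul, Finset.mul_sum, mul_assoc]
      rw [Finset.sum_comm]
      ring
    have h2 : x - x₀ = ∑ j, (k' j : ℝ) • g j + ∑ i, (∑ j', K i j' * k j') • l i := by
      rw [hk]
      simp only [l, ← Int.cast_smul_eq_zsmul ℝ, Finset.smul_sum (N := E), smul_smul]
      rw [Finset.sum_comm, ← Finset.sum_add_distrib]
      refine Finset.sum_congr rfl fun j _ => ?_
      rw [← Finset.sum_smul, ← add_smul]
      congr 1
      rw [h1 j]
      push_cast
      congr 1
      exact Finset.sum_congr rfl fun i _ => mul_comm _ _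
    rw [add_assoc, ← h2]
    abel
  simp only [Set.mem_iUnion]
  refine ⟨_, Finset.mem_image_of_mem _ hbox, ?_⟩
  rw [Set.mem_vadd_set]
  refine ⟨∑ i, (∑ j', K i j' * k j') • l i, ?_, hdecomp.symm⟩
  rw [hlb]
  exact Submodule.sum_mem _ fun i _ => Submodule.smul_mem _ _ (Submodule.subset_span ⟨i, rfl⟩)

end LatticeCover

/-! ### Covering the spectrum by translates of the dual lattice. -/

section Spectrum

theorem Set.Pairwise.eventually_eq_of_norm_sub_lt {d : ℝ} (hd : 0 < d) {E : Type*} [NormedAddCommGroup E] {S : Set E}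
    (hS : S.Pairwise fun x y => d ≤ dist x y) (w : E) :
    ∀ᶠ r in 𝓝[>] (0 : ℝ), ∀ s ∈ S, ‖s - w‖ < r → s = w := by
  obtain ⟨r₀, hr₀, h⟩ : ∃ r₀ : ℝ, 0 < r₀ ∧ ∀ s ∈ S, ‖s - w‖ < r₀ → s = w := by
    by_cases hex : ∃ s ∈ S, s ≠ w ∧ ‖s - w‖ < d / 2
    · obtain ⟨s₁, hs₁, hne, hlt⟩ := hex
      refine ⟨‖s₁ - w‖, norm_pos_iff.mpr (sub_ne_zero.mpr hne), fun s hs hsw => ?_⟩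
      have hss : s ≠ s₁ := by
        rintro rfl
        exact lt_irrefl _ hsw
      have h1 : d ≤ dist s s₁ := hS hs hs₁ hss
      have h2 := dist_triangle_right s s₁ w
      rw [dist_eq_norm s w, dist_eq_norm s₁ w] at h2
      linarith
    · push Not at hex
      refine ⟨d / 2, by positivity, fun s hs hsw => ?_⟩
      by_contra hne
      exact absurd hsw (not_lt.mpr (hex s hs hne))
  filter_upwards [Ioo_mem_nhdsGT hr₀] with r hr s hs hsr
  exact h s hs (hsr.trans hr.2)

variable {E : Type*} [NormedAddCommGroup E] [InnerProductSpace ℝ E]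

/-- If a finite union of translates of `L` is given and `M` pairs integrally with `L`, then the
constant `1` is, on this union, a combination of the characters given by a translate of some fixed
finite subset of `M`. -/
theorem exists_finset_one_eq_sum_fourierChar {L M : Submodule ℤ E}
    (hLM : ∀ y ∈ M, ∀ x ∈ L, ∃ k : ℤ, ⟪y, x⟫_ℝ = k) (F : Finset E) :
    ∃ D : Finset M, ∀ y₁ : M, ∃ a : M → ℂ,
      ∀ x ∈ ⋃ θ ∈ F, θ +ᵥ (L : Set E), ∑ y ∈ D, a y * 𝐞 ⟪((y + y₁ : M) : E), x⟫_ℝ = 1 := by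
  classical
  -- On the union, a character from `M` is determined by its values on `F`. These vectors lie in the
  -- finite dimensional `F → ℂ`, so a finite `D` spans them all, independently of `y₁`.
  let e : M → F → ℂ := fun y θ => 𝐞 ⟪(y : E), θ⟫_ℝ
  obtain ⟨s', hs', hspan⟩ := (Submodule.fg_span_iff_fg_span_finset_subset (R := ℂ)
    (Set.range e)).mp (IsNoetherian.noetherian _)
  rw [← Set.image_univ, Finset.subset_set_image_iff] at hs'
  obtain ⟨D, -, rfl⟩ := hs'
  refine ⟨D, fun y₁ => ?_⟩
  -- Expanding the character of `-y₁` and multiplying by that of `y₁` yields 1.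
  have h1 : e (-y₁) ∈ Submodule.span ℂ (e '' (D : Set M)) := by
    rw [← Finset.coe_image, ← hspan]
    exact Submodule.subset_span ⟨_, rfl⟩
  obtain ⟨a, ha⟩ := (Submodule.mem_span_image_finset_iff_exists_fun' ℂ).mp h1
  refine ⟨a, fun x hx => ?_⟩
  simp only [Set.mem_iUnion] at hx
  obtain ⟨θ, hθ, hx⟩ := hx
  obtain ⟨z, hz, rfl⟩ := Set.mem_vadd_set.mp hx
  have hz1 (y : M) : 𝐞 ⟪(y : E), θ +ᵥ z⟫_ℝ = 𝐞 ⟪(y : E), θ⟫_ℝ := by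
    obtain ⟨k, hk⟩ := hLM y y.2 z hz
    rw [vadd_eq_add, inner_add_right, hk, AddChar.map_add_eq_mul, fourierChar_intCast, mul_one]
  have h2 := congrFun ha ⟨θ, hθ⟩
  simp only [Finset.sum_apply, Pi.smul_apply, smul_eq_mul, e] at h2
  simp only [hz1]
  have h3 (y : M) : a y * (𝐞 ⟪((y + y₁ : M) : E), θ⟫_ℝ : ℂ) =
      a y * 𝐞 ⟪(y : E), θ⟫_ℝ * 𝐞 ⟪(y₁ : E), θ⟫_ℝ := by
    rw [Submodule.coe_add, inner_add_left, AddChar.map_add_eq_mul, Circle.coe_mul, mul_assoc]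
  simp only [h3]
  rw [← Finset.sum_mul, h2, ← Circle.coe_mul, ← AddChar.map_add_eq_mul, ← inner_add_left]
  simp

variable [FiniteDimensional ℝ E] [MeasurableSpace E] [BorelSpace E] {Λ S : Set E} {m : E → ℝ}
  {b : E → ℂ}

namespace PoissonPair

/-- Multiplying the measure by the character of `w i` translates its spectrum by `w i`. Writing 1 as
a combination of these characters therefore forces `S ⊆ ⋃ (S + w i)`; a bump isolating `s` makes
this precise. -/
theorem exists_sub_mem (h : PoissonPair Λ S m b) (hb : ∀ s ∈ S, b s ≠ 0) {ι : Type*}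
    (D : Finset ι) (w : ι → E) (a : ι → ℂ) (hone : ∀ x ∈ Λ, ∑ i ∈ D, a i * 𝐞 ⟪w i, x⟫_ℝ = 1)
    {s : E} (hs : s ∈ S) : ∃ i ∈ D, s - w i ∈ S := by
  by_contra hcon
  push Not at hcon
  obtain ⟨d, hd, hS⟩ := h.sep_right
  have hev := (hS.eventually_eq_of_norm_sub_lt hd s).and
    ((Finset.eventually_all D).mpr fun i _ => hS.eventually_eq_of_norm_sub_lt hd (s - w i))
  obtain ⟨r, ⟨hr1, hr2⟩, hr0⟩ := (hev.and self_mem_nhdsWithin).exists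
  have hr0 : 0 < r := hr0
  let f : ContDiffBump s := ⟨r / 2, r, by positivity, by linarith⟩
  let φ : E → ℂ := fun x => (f x : ℂ)
  have h1 : ContDiff ℝ ∞ φ := Complex.ofRealCLM.contDiff.comp f.contDiff
  have h2 : HasCompactSupport φ := f.hasCompactSupport.comp_left (g := Complex.ofReal) rfl
  have hφ (x : E) (hx : φ x ≠ 0) : ‖x - s‖ < r := by
    have : x ∈ Function.support f := fun h => hx (by simp [φ, h])
    rw [f.support_eq] at this
    simpa [dist_eq_norm] using this
  have hφs : φ s = 1 := by
    simp only [φ]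
    rw [f.one_of_mem_closedBall (Metric.mem_closedBall_self f.rIn_pos.le), Complex.ofReal_one]
  have hP := h.poisson φ h1 h2
  rw [tsum_eq_single (f := fun s : S => b s * φ s) ⟨s, hs⟩] at hP
  · have hzero (i) (hi : i ∈ D) : ∑' x : Λ, (m x : ℂ) * (𝐞 ⟪w i, x⟫_ℝ * 𝓕 φ x) = 0 := by
      have hPi := h.poisson (fun v => φ (v - -w i)) (h1.comp (contDiff_id.sub contDiff_const))
        (h2.comp_homeomorph (Homeomorph.subRight (-w i)))
      have hz (s' : S) : b s' * φ (s' - -w i) = 0 := by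
        refine mul_eq_zero_of_right _ ?_
        by_contra hne
        have h3 := hφ _ hne
        rw [show (s' : E) - -w i - s = s' - (s - w i) by abel] at h3
        exact hcon i hi (hr2 i hi s' s'.2 h3 ▸ s'.2)
      rw [tsum_congr hz, tsum_zero] at hPi
      rw [← hPi]
      refine tsum_congr fun x => ?_
      rw [fourier_translate, inner_neg_left, neg_neg, Circle.smul_def, smul_eq_mul]
    obtain ⟨K, hK, hKφ⟩ := exists_norm_fourier_le_decay h1 h2
    have hsum : Summable fun x : Λ => m x * ‖𝓕 φ x‖ :=
      h.summable_of_le_decay 0 (K := K) (g := fun x => ‖𝓕 φ x‖) fun x => by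
        rw [abs_of_nonneg (norm_nonneg _), sub_zero]
        exact hKφ x
    have hsumi (i) : Summable fun x : Λ => (m x : ℂ) * (𝐞 ⟪w i, x⟫_ℝ * 𝓕 φ x) := by
      refine hsum.of_norm_bounded fun x => ?_
      rw [norm_mul, norm_mul, Circle.norm_coe, one_mul, Complex.norm_real, Real.norm_eq_abs,
        abs_of_pos (h.pos x x.2)]
    have hterm (x : Λ) : (m x : ℂ) * 𝓕 φ x =
        ∑ i ∈ D, a i * ((m x : ℂ) * (𝐞 ⟪w i, x⟫_ℝ * 𝓕 φ x)) := by
      calc (m x : ℂ) * 𝓕 φ x = (∑ i ∈ D, a i * 𝐞 ⟪w i, x⟫_ℝ) * ((m x : ℂ) * 𝓕 φ x) := by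
            rw [hone x x.2, one_mul]
        _ = _ := by
            rw [Finset.sum_mul]
            exact Finset.sum_congr rfl fun i _ => by ring
    rw [tsum_congr hterm, Summable.tsum_finsetSum fun i _ => (hsumi i).mul_left _,
      Finset.sum_eq_zero fun i hi => by rw [tsum_mul_left, hzero i hi, mul_zero], hφs, mul_one]
      at hP
    exact hb s hs hP.symm
  · intro s' hs'
    refine mul_eq_zero_of_right _ ?_
    by_contra hne
    exact hs' (Subtype.ext (hr1 s' s'.2 (hφ _ hne)))

/-- The spectrum is contained in finitely many translates of the dual lattice. -/
theorem exists_spectrum_cover (h : PoissonPair Λ S m b) (hb : ∀ s ∈ S, b s ≠ 0)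
    {L : Submodule ℤ E} {ι : Type*} [Finite ι] (p : Module.Basis ι ℝ E)
    (hLM : ∀ y ∈ Submodule.span ℤ (Set.range p), ∀ x ∈ L, ∃ k : ℤ, ⟪y, x⟫_ℝ = k) {F : Finset E}
    (hF : Λ ⊆ ⋃ θ ∈ F, θ +ᵥ (L : Set E)) :
    ∃ G : Finset E, S ⊆ ⋃ θ ∈ G, θ +ᵥ (Submodule.span ℤ (Set.range p) : Set E) := by
  cases nonempty_fintype ι
  obtain ⟨D, hD⟩ := exists_finset_one_eq_sum_fourierChar hLM F
  obtain ⟨d, hd, hS⟩ := h.sep_right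
  have hfin := hS.finite_inter_closedBall hd (∑ i, ‖p i‖ + ∑ y ∈ D, ‖(y : E)‖)
  refine ⟨hfin.toFinset, fun s hs => ?_⟩
  -- Shifting `D` by the integral part of `s` leaves `fract s - y`, which is bounded uniformly in
  -- `s`.
  obtain ⟨a, ha⟩ := hD (ZSpan.floor p s)
  obtain ⟨y, hy, hys⟩ := h.exists_sub_mem hb D
    (fun y => ((y + ZSpan.floor p s : Submodule.span ℤ (Set.range p)) : E)) a
    (fun x hx => ha x (hF hx)) hs
  simp only [Set.mem_iUnion]
  refine ⟨_, hfin.mem_toFinset.mpr ⟨hys, ?_⟩, ?_⟩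
  · rw [mem_closedBall_zero_iff]
    have e : s - ((y + ZSpan.floor p s : Submodule.span ℤ (Set.range p)) : E) =
        ZSpan.fract p s - y := by
      rw [ZSpan.fract_apply, Submodule.coe_add]
      abel
    rw [e]
    refine (norm_sub_le _ _).trans (add_le_add (ZSpan.norm_fract_le p s) ?_)
    exact Finset.single_le_sum (f := fun y : Submodule.span ℤ (Set.range p) => ‖(y : E)‖)
      (fun _ _ => norm_nonneg _) hy
  · rw [Set.mem_vadd_set]
    exact ⟨_, (y + ZSpan.floor p s).2, by rw [vadd_eq_add, sub_add_cancel]⟩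

/-- The support is contained in finitely many translates of a lattice. -/
theorem exists_support_cover (h : PoissonPair Λ S m b) :
    ∃ (ι : Type) (_ : Fintype ι) (l : Module.Basis ι ℝ E) (F : Finset E),
      Λ ⊆ ⋃ θ ∈ F, θ +ᵥ (Submodule.span ℤ (Set.range l) : Set E) := by
  rcases Λ.eq_empty_or_nonempty with rfl | ⟨x₀, hx₀⟩
  · exact ⟨_, inferInstance, Module.finBasis ℝ E, ∅, Set.empty_subset _⟩
  · obtain ⟨R, -, hR⟩ := h.exists_relatively_dense
    obtain ⟨d, hd, hΛ⟩ := h.sep_left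
    obtain ⟨dS, hdS, hS⟩ := h.sep_right
    exact exists_lattice_cover (hΛ.finite_inter_closedBall hd) hR hx₀ hdS
      fun f y C hf hC hy => h.eq_zero_of_bounded hS hx₀ f hf hC hy

end PoissonPair

end Spectrum

end

/-! ### Conclusion. -/

theorem theorem2 (n : ℕ) (hn : 1 < n)
    (μ : Measure (EuclideanSpace ℝ (Fin n))) [IsLocallyFiniteMeasure μ]
    (Λ S : Set (EuclideanSpace ℝ (Fin n)))
    (T : 𝓢'(EuclideanSpace ℝ (Fin n), ℂ)) (hT : IsDistributionOfMeasure T μ)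
    (hμ : IsAtomicOn μ Λ)
    (b : EuclideanSpace ℝ (Fin n) → ℂ) (hS : IsComplexAtomicOn (𝓕 T) S b) :
    ∃ (L : Submodule ℤ (EuclideanSpace ℝ (Fin n))) (_ : DiscreteTopology L),
      IsZLattice ℝ L ∧
      (∃ F : Finset (EuclideanSpace ℝ (Fin n)),
        Λ ⊆ ⋃ θ ∈ F, θ +ᵥ (L : Set (EuclideanSpace ℝ (Fin n)))) ∧
      (∃ G : Finset (EuclideanSpace ℝ (Fin n)),
        S ⊆ ⋃ ω ∈ G, ω +ᵥ (dualLattice L : Set (EuclideanSpace ℝ (Fin n)))) := by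
  classical
  have h := hμ.poissonPair hT hS
  obtain ⟨ι, _, l, F, hF⟩ := h.exists_support_cover
  have hnd : LinearMap.BilinForm.Nondegenerate (innerₗ (EuclideanSpace ℝ (Fin n))) := by
    constructor <;> intro x hx <;> simpa using hx x
  have hdual : dualLattice (Submodule.span ℤ (Set.range l)) =
      Submodule.span ℤ (Set.range (LinearMap.BilinForm.dualBasis _ hnd l)) :=
    LinearMap.BilinForm.dualSubmodule_span_of_basis _ hnd l
  refine ⟨Submodule.span ℤ (Set.range l), inferInstance, inferInstance, ⟨F, hF⟩, ?_⟩
  rw [hdual]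
  refine h.exists_spectrum_cover hS.mass_ne_zero _ (fun y hy x hx => ?_) hF
  rw [← hdual, mem_dualLattice] at hy
  exact hy x hx
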